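/- Let $E_0,E_1$ be Banach spaces with $E_1$ continuously and densely embedded in $E_0$. For $\theta\in(0,1)$ let $E_\theta=(E_0,E_1)^0_{\theta,\infty}$ be the continuous interpolation space. For $T>0$ and $\nu\in(0,1)$ let $BC_{1-\nu}([0,T],E)$ be the set of $v\in C((0,T],E)$ such that $t^{1-\nu}v(t)$ is bounded on $(0,T]$ and tends to $0$ as $t\to0^+$, and put $\mathbb E_{0,\nu}([0,T])=BC_{1-\nu}([0,T],E_0)$ and $$\mathbb E_{1,\nu}([0,T])=\{v\in C^1((0,T],E_0): v,\dot v\in BC_{1-\nu}([0,T],E_0)\}\cap BC_{1-\nu}([0,T],E_1),$$ with norm $\|v\|_{\mathbb E_{1,\nu}([0,T])}=\sup_{0<t\le T}t^{1-\nu}(|\dot v(t)|_{E_0}+|v(t)|_{E_1})$; for such $v$, $v(0)$ denotes the limit of $v(t)$ in $E_0$ as $t\to0^+$. Let $\mathcal M_\nu(E_1,E_0)$ be the set of $B\in\mathcal L(E_1,E_0)$ such that, for some $T>0$ and for all $f\in\mathbb E_{0,\nu}([0,T])$ and $x\in E_\nu$, the problem $\dot v+Bv=f$ on $(0,T]$,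 $v(0)=x$, has a unique solution $v\in\mathbb E_{1,\nu}([0,T])$. Let $0<\mu<\beta<1$, let $V_\mu\subset E_\mu$ be open, and assume: (H1) $(A,F_1):V_\mu\to\mathcal M_\mu(E_1,E_0)\times E_0$ is locally Lipschitz continuous, where $V_\mu$ carries the norm of $E_\mu$ and $\mathcal M_\mu(E_1,E_0)$ the norm of $\mathcal L(E_1,E_0)$. (H2) $F_2:V_\mu\cap E_\beta\to E_0$, and there are $m\in\mathbb N$, $\beta_j\in[\mu,\beta]$ and $\rho_j\ge0$ with $\frac{\rho_j(\beta-\mu)+(\beta_j-\mu)}{1-\mu}\le1$ ($j=1,\dots,m$), such that for all $x_0\in V_\mu$ and $R>0$ there is $C_R=C_R(x_0)>0$ with $$|F_2(x_1)-F_2(x_2)|_{E_0}\le C_R\sum_{j=1}^m\bigl(1+|x_1|_{E_\beta}^{\rho_j}+|x_2|_{E_\beta}^{\rho_j}\bigr)|x_1-x_2|_{E_{\beta_j}}$$ for all $x_1,x_2\in\bar B_{E_\mu}(x_0,R)\cap V_\mu\cap E_\beta$. For $\nu\in(0,1)$, $T>0$ and $x\in V_\mu$, an $E_\nu$-solution on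 $[0,T]$ with initial value $x$ is a function $v\in\mathbb E_{1,\nu}([0,T])$ with values in $V_\mu$ such that $\dot v+A(v)v=F_1(v)+F_2(v)$ on $(0,T]$ and $v(0)=x$. **Proposition.** Let $\bar\mu\in[\beta,1)$ and $x_0\in V_\mu\cap E_{\bar\mu}$. Then there are constants $\tau,\varepsilon,\sigma>0$ (depending on $x_0$) such that $\bar B_{E_{\bar\mu}}(x_0,\varepsilon)\subset V_\mu$ and, for every $x\in\bar B_{E_{\bar\mu}}(x_0,\varepsilon)$, there is a unique $E_{\bar\mu}$-solution $u(\cdot,x)\in\mathbb E_{1,\bar\mu}([0,\tau])$ on $[0,\tau]$ with initial value $x$. Moreover $$\|u(\cdot,x_1)-u(\cdot,x_2)\|_{\mathbb E_{1,\bar\mu}([0,\tau])}\le\sigma|x_1-x_2|_{E_{\bar\mu}},\qquad x_1,x_2\in\bar B_{E_{\bar\mu}}(x_0,\varepsilon).$$ These solutions coincide with the $E_\mu$-solutions: for every $x\in\bar B_{E_{\bar\mu}}(x_0,\varepsilon)$, $u(\cdot,x)$ is also an $E_\mu$-solution on $[0,\tau]$, and for each $T>0$, every $E_\mu$-solution $v$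 on $[0,T]$ with initial value $x$ satisfies $v=u(\cdot,x)$ on $(0,\min\{T,\tau\}]$ and belongs to $\mathbb E_{1,\bar\mu}([0,T])$. -/

import Mathlib

open Filter Topology Set

namespace ContMaxReg

noncomputable section

variable {E₀ E₁ : Type*} [NormedAddCommGroup E₀] [NormedSpace ℝ E₀]
  [NormedAddCommGroup E₁] [NormedSpace ℝ E₁]

/-! Throughout, `i : E₁ →L[ℝ] E₀` is the continuous embedding of `E₁` into `E₀`. -/

/-- The `K`-functional `K(t,x) = inf { |a|_{E₀} + t |b|_{E₁} : x = a + b }` of the couple. -/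
def kFun (i : E₁ →L[ℝ] E₀) (t : ℝ) (x : E₀) : ℝ :=
  ⨅ b : E₁, ‖x - i b‖ + t * ‖b‖

/-- The continuous interpolation space `E_θ = (E₀, E₁)_{θ,∞}^0`, `0 < θ < 1`, as a subset of `E₀`:
all `x` with `t^{-θ} K(t,x) → 0` as `t → 0+`.
As `K(t,x) ≤ |x|_{E₀}`, the decay at `t → ∞` is automatic. -/
def interpSpace (i : E₁ →L[ℝ] E₀) (θ : ℝ) : Set E₀ :=
  {x | Tendsto (fun t : ℝ => t ^ (-θ) * kFun i t x) (𝓝[>] 0) (𝓝 0)}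

/-- The norm `|x|_{E_θ} = sup_{t > 0} t^{-θ} K(t,x)` of the interpolation space
(the supremum is finite on `interpSpace i θ`, see `bddAbove_interpNorm`). -/
def interpNorm (i : E₁ →L[ℝ] E₀) (θ : ℝ) (x : E₀) : ℝ :=
  ⨆ t : Ioi (0 : ℝ), (t : ℝ) ^ (-θ) * kFun i t x

theorem kFun_le_norm (i : E₁ →L[ℝ] E₀) {t : ℝ} (ht : 0 ≤ t) (x : E₀) : kFun i t x ≤ ‖x‖ := by
  have hb : BddBelow (range fun b : E₁ => ‖x - i b‖ + t * ‖b‖) :=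
    ⟨0, by rintro _ ⟨b, rfl⟩; positivity⟩
  simpa [kFun] using ciInf_le hb 0

theorem bddAbove_interpNorm (i : E₁ →L[ℝ] E₀) {θ : ℝ} (hθ : 0 ≤ θ) {x : E₀}
    (hx : x ∈ interpSpace i θ) :
    BddAbove (range fun t : Ioi (0 : ℝ) => (t : ℝ) ^ (-θ) * kFun i t x) := by
  have h1 : ∀ᶠ t in 𝓝[>] (0 : ℝ), t ^ (-θ) * kFun i t x < 1 :=
    (show Tendsto _ _ _ from hx).eventually (gt_mem_nhds one_pos)
  obtain ⟨δ, hδ, hδ'⟩ := mem_nhdsGT_iff_exists_Ioo_subset.1 h1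
  have hδ0 : (0 : ℝ) < δ := hδ
  refine ⟨max 1 (δ ^ (-θ) * ‖x‖), ?_⟩
  rintro _ ⟨⟨t, ht⟩, rfl⟩
  have ht0 : (0 : ℝ) < t := ht
  rcases lt_or_ge t δ with h | h
  · exact le_max_of_le_left (le_of_lt (hδ' ⟨ht0, h⟩))
  · refine le_max_of_le_right ?_
    have h2 : t ^ (-θ) ≤ δ ^ (-θ) := Real.rpow_le_rpow_of_nonpos hδ0 h (by linarith)
    calc t ^ (-θ) * kFun i t x ≤ t ^ (-θ) * ‖x‖ := by
          gcongr
          exact kFun_le_norm i ht0.le x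
      _ ≤ δ ^ (-θ) * ‖x‖ := by gcongr

/-- `V` is an open subset of the normed space `E_θ`. -/
def IsOpenInterp (i : E₁ →L[ℝ] E₀) (θ : ℝ) (V : Set E₀) : Prop :=
  V ⊆ interpSpace i θ ∧
    ∀ x ∈ V, ∃ r > 0, ∀ y ∈ interpSpace i θ, interpNorm i θ (y - x) < r → y ∈ V

/-- The closed ball of `E_θ` with centre `x₀` and radius `r`. -/
def closedBallInterp (i : E₁ →L[ℝ] E₀) (θ : ℝ) (x₀ : E₀) (r : ℝ) : Set E₀ :=
  {x | x ∈ interpSpace i θ ∧ interpNorm i θ (x - x₀) ≤ r}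

/-- `v ∈ BC_{1-μ}([0,T], E)`: `v` is continuous on `(0,T]`, `t^{1-μ} v(t)` is bounded there, and
`t^{1-μ} |v(t)| → 0` as `t → 0+`. Only the values of `v` on `(0,T]` matter. -/
structure MemBC {E : Type*} [NormedAddCommGroup E] (μ T : ℝ) (v : ℝ → E) : Prop where
  continuousOn : ContinuousOn v (Ioc 0 T)
  bounded : ∃ C : ℝ, ∀ t ∈ Ioc (0 : ℝ) T, t ^ (1 - μ) * ‖v t‖ ≤ C
  tendsto_zero : Tendsto (fun t : ℝ => t ^ (1 - μ) * ‖v t‖) (𝓝[>] 0) (𝓝 0)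

/-- The time derivative in `E₀`, on `(0,T]`, of a function with values in `E₁`
(one-sided at `t = T`). -/
def timeDeriv (i : E₁ →L[ℝ] E₀) (T : ℝ) (v : ℝ → E₁) (t : ℝ) : E₀ :=
  derivWithin (fun s => i (v s)) (Ioc 0 T) t

/-- `v ∈ 𝔼_{1,μ}([0,T]) = BC_{1-μ}^1([0,T], E₀) ∩ BC_{1-μ}([0,T], E₁)`. Elements are represented by
functions `ℝ → E₁`, of which only the values on `(0,T]` matter. -/
structure MemE1 (i : E₁ →L[ℝ] E₀) (μ T : ℝ) (v : ℝ → E₁) : Prop where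
  differentiableOn : DifferentiableOn ℝ (fun t => i (v t)) (Ioc 0 T)
  memBC_zero : MemBC μ T (fun t => i (v t))
  memBC_deriv : MemBC μ T (timeDeriv i T v)
  memBC_one : MemBC μ T v

/-- The norm `sup_{0 < t ≤ T} t^{1-μ} (|v'(t)|_{E₀} + |v(t)|_{E₁})` of `𝔼_{1,μ}([0,T])`. -/
def normE1 (i : E₁ →L[ℝ] E₀) (μ T : ℝ) (v : ℝ → E₁) : ℝ :=
  ⨆ t : Ioc (0 : ℝ) T, (t : ℝ) ^ (1 - μ) * (‖timeDeriv i T v t‖ + ‖v t‖)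

/-- The initial condition `v(0) = x`: the trace of `v` at `t = 0`, taken in `E₀`, is `x`. -/
def HasTrace (i : E₁ →L[ℝ] E₀) (v : ℝ → E₁) (x : E₀) : Prop :=
  Tendsto (fun t => i (v t)) (𝓝[>] 0) (𝓝 x)

/-- `v ∈ 𝔼_{1,μ}([0,T])` solves the linear problem `v' + B v = f` on `(0,T]`, `v(0) = x`. -/
def IsLinearSolution (i : E₁ →L[ℝ] E₀) (μ T : ℝ) (B : E₁ →L[ℝ] E₀) (f : ℝ → E₀) (x : E₀)
    (v : ℝ → E₁) : Prop :=
  MemE1 i μ T v ∧ HasTrace i v x ∧ ∀ t ∈ Ioc (0 : ℝ) T, timeDeriv i T v t + B (v t) = f t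

/-- The class `ℳ_μ(E₁, E₀)` of operators with continuous maximal regularity: for some `T > 0`,
every `f ∈ 𝔼_{0,μ}([0,T]) = BC_{1-μ}([0,T], E₀)` and every `x ∈ E_μ`, the linear problem has a
unique solution in `𝔼_{1,μ}([0,T])`. -/
def maxReg (i : E₁ →L[ℝ] E₀) (μ : ℝ) : Set (E₁ →L[ℝ] E₀) :=
  {B | ∃ T > 0, ∀ f : ℝ → E₀, MemBC μ T f → ∀ x ∈ interpSpace i μ,
    ∃ v, IsLinearSolution i μ T B f x v ∧
      ∀ w, IsLinearSolution i μ T B f x w → EqOn w v (Ioc 0 T)}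

/-- `(A, F₁) ∈ C^{1-}(V, ℳ_μ(E₁,E₀) × E₀)`: `A` takes values in `ℳ_μ(E₁,E₀)` on `V`, and `A`, `F₁`
are locally Lipschitz continuous on `V ⊆ E_μ` in the norm of `E_μ`. -/
def LocLipCoefficients (i : E₁ →L[ℝ] E₀) (μ : ℝ) (V : Set E₀) (A : E₀ → E₁ →L[ℝ] E₀)
    (F₁ : E₀ → E₀) : Prop :=
  (∀ x ∈ V, A x ∈ maxReg i μ) ∧
  ∀ x ∈ V, ∃ r > 0, ∃ L : ℝ, ∀ y ∈ V, ∀ z ∈ V,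
    interpNorm i μ (y - x) < r → interpNorm i μ (z - x) < r →
      ‖A y - A z‖ ≤ L * interpNorm i μ (y - z) ∧ ‖F₁ y - F₁ z‖ ≤ L * interpNorm i μ (y - z)

/-- The structural condition on `F₂ : V ∩ E_β → E₀` with exponents `ρ j ≥ 0`,
`b j ∈ [μ, β]` satisfying `(ρ j (β - μ) + (b j - μ)) / (1 - μ) ≤ 1`.
Only the values of `F₂` on `V ∩ E_β` matter. -/
def SingularStructure (i : E₁ →L[ℝ] E₀) (μ β : ℝ) (V : Set E₀) (F₂ : E₀ → E₀) : Prop :=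
  ∃ (m : ℕ) (b ρ : Fin m → ℝ),
    (∀ j, b j ∈ Icc μ β ∧ 0 ≤ ρ j ∧ (ρ j * (β - μ) + (b j - μ)) / (1 - μ) ≤ 1) ∧
    ∀ x₀ ∈ V, ∀ R > 0, ∃ C > 0,
      ∀ x₁ ∈ closedBallInterp i μ x₀ R ∩ (V ∩ interpSpace i β),
      ∀ x₂ ∈ closedBallInterp i μ x₀ R ∩ (V ∩ interpSpace i β),
        ‖F₂ x₁ - F₂ x₂‖ ≤ C * ∑ j, (1 + interpNorm i β x₁ ^ ρ j + interpNorm i β x₂ ^ ρ j) *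
          interpNorm i (b j) (x₁ - x₂)

/-- `v ∈ 𝔼_{1,ν}([0,T])` solves the quasilinear problem
`v' + A(v) v = F₁(v) + F₂(v)` on `(0,T]`, `v(0) = x`, with values in `V`. -/
def IsSolution (i : E₁ →L[ℝ] E₀) (ν T : ℝ) (V : Set E₀) (A : E₀ → E₁ →L[ℝ] E₀)
    (F₁ F₂ : E₀ → E₀) (x : E₀) (v : ℝ → E₁) : Prop :=
  MemE1 i ν T v ∧ x ∈ V ∧ HasTrace i v x ∧
  ∀ t ∈ Ioc (0 : ℝ) T, i (v t) ∈ V ∧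
    timeDeriv i T v t + A (i (v t)) (v t) = F₁ (i (v t)) + F₂ (i (v t))

end

end ContMaxReg

open ContMaxReg

namespace ContMaxReg

/-! ### The K-functional and the spaces E_θ -/

section Interpolation

variable {E₀ E₁ : Type*} [NormedAddCommGroup E₀] [NormedSpace ℝ E₀]
  [NormedAddCommGroup E₁] [NormedSpace ℝ E₁] (i : E₁ →L[ℝ] E₀)

/-! Freeze the coefficient at x₀: with B = A(x₀) the equation reads v' + Bv = (B − A(v))v + F₁(v) +
F₂(v), and near x₀ and for short times the right-hand side is a small perturbation. Write ν for the
higher weight (`μ'` in the final theorem).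

Linear theory. Maximal regularity is assumed at weight μ on some interval, but estimates at weight ν
≥ μ are needed, uniform on shorter intervals. For zero initial value the solution operator is
bounded at weight μ by the closed graph theorem. By uniqueness on short intervals, v(t) depends only
on f on (0,t], where the μ-norm of f is at most t^(ν−μ) times its ν-norm. Cancelling this power
turns the μ-estimate into the ν-estimate (`weight_le_of_isPrimitive_zero`). A general x ∈ E_ν is
reduced to zero by subtracting an extension made of averaged, almost optimal decompositions in the
K-functional (`exists_isPrimitive_of_mem_interpSpace`). The trace estimate adds control in E_ν, and
all this is collected in `exists_linear_estimate`.

Existence. Since ν ≥ β, the E_β-norm is bounded on balls of E_ν, so F₂ is Lipschitz there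
(`exists_lipschitz_coefficients`). The contraction principle is applied to the right-hand side f:
solve the linear problem with data (f, x), then evaluate the perturbation. The contraction is
uniform in x, and the same difference estimate yields Lipschitz dependence on x
(`exists_isPrimitive_quasilinear`).

Uniqueness holds already among E_μ-solutions (`IsSolution.eqOn`), and here the exponents matter. An
E_μ-solution satisfies t^(β−μ)|v(t)|_{E_β} → 0, so the factors t^(1−β_j)|v(t)|_{E_β}^{ρ_j} tend to
0, even when equality holds in the exponent condition. Hence the difference of two solutions
vanishes near 0, and a restart argument propagates this. An E_μ-solution therefore agrees with u
near 0; since the weight only restricts behaviour at 0, it has the higher weight too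
(`IsSolution.of_eqOn`). -/

theorem bddBelow_kFun {t : ℝ} (ht : 0 ≤ t) (x : E₀) :
    BddBelow (range fun b : E₁ => ‖x - i b‖ + t * ‖b‖) :=
  ⟨0, by rintro _ ⟨b, rfl⟩; positivity⟩

theorem kFun_le {t : ℝ} (ht : 0 ≤ t) (x : E₀) (b : E₁) : kFun i t x ≤ ‖x - i b‖ + t * ‖b‖ :=
  ciInf_le (bddBelow_kFun i ht x) b

theorem le_kFun {t c : ℝ} {x : E₀} (h : ∀ b : E₁, c ≤ ‖x - i b‖ + t * ‖b‖) : c ≤ kFun i t x :=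
  le_ciInf h

theorem exists_lt_of_kFun_lt {t c : ℝ} {x : E₀} (h : kFun i t x < c) :
    ∃ b : E₁, ‖x - i b‖ + t * ‖b‖ < c :=
  exists_lt_of_ciInf_lt h

theorem kFun_nonneg {t : ℝ} (ht : 0 ≤ t) (x : E₀) : 0 ≤ kFun i t x :=
  le_kFun i fun b => by positivity

theorem kFun_zero {t : ℝ} (ht : 0 ≤ t) : kFun i t (0 : E₀) = 0 :=
  le_antisymm (by simpa using kFun_le_norm i ht (0 : E₀)) (kFun_nonneg i ht 0)

theorem kFun_apply_le {t : ℝ} (ht : 0 ≤ t) (b : E₁) : kFun i t (i b) ≤ t * ‖b‖ := by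
  simpa using kFun_le i ht (i b) b

theorem kFun_neg (t : ℝ) (x : E₀) : kFun i t (-x) = kFun i t x := by
  unfold kFun
  refine (Equiv.neg E₁).iInf_congr fun b => ?_
  have : x - i ((Equiv.neg E₁) b) = -(-x - i b) := by simp; abel
  rw [this, norm_neg]
  simp

theorem kFun_add_le {t : ℝ} (ht : 0 ≤ t) (x y : E₀) :
    kFun i t (x + y) ≤ kFun i t x + kFun i t y := by
  refine le_of_forall_pos_le_add fun ε hε => ?_
  obtain ⟨a, ha⟩ := exists_lt_of_kFun_lt i (lt_add_of_pos_right (kFun i t x) (half_pos hε))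
  obtain ⟨b, hb⟩ := exists_lt_of_kFun_lt i (lt_add_of_pos_right (kFun i t y) (half_pos hε))
  have h1 := kFun_le i ht (x + y) (a + b)
  have h2 : ‖x + y - i (a + b)‖ ≤ ‖x - i a‖ + ‖y - i b‖ := by
    rw [map_add, add_sub_add_comm]; exact norm_add_le _ _
  have h3 : t * ‖a + b‖ ≤ t * ‖a‖ + t * ‖b‖ := by
    rw [← mul_add]; exact mul_le_mul_of_nonneg_left (norm_add_le _ _) ht
  linarith

theorem kFun_mono {s t : ℝ} (hs : 0 ≤ s) (hst : s ≤ t) (x : E₀) : kFun i s x ≤ kFun i t x :=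
  le_kFun i fun b => (kFun_le i hs x b).trans (by gcongr)

/-- Split x = (x − i b) + i b. This gives the embedding E_θ ↪ E₀ and the positivity of K away from x
= 0. -/
theorem norm_le_kFun_one (x : E₀) : ‖x‖ ≤ (1 + ‖i‖) * kFun i 1 x := by
  have hc : (0 : ℝ) < 1 + ‖i‖ := by positivity
  rw [mul_comm, ← div_le_iff₀ hc]
  refine le_kFun i fun b => ?_
  rw [div_le_iff₀ hc]
  have h1 : ‖x‖ ≤ ‖x - i b‖ + ‖i b‖ := by simpa using norm_add_le (x - i b) (i b)
  have h2 := i.le_opNorm b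
  nlinarith [norm_nonneg (x - i b), norm_nonneg b, norm_nonneg i,
    mul_nonneg (norm_nonneg i) (norm_nonneg (x - i b))]

theorem interpNorm_nonneg (θ : ℝ) (x : E₀) : 0 ≤ interpNorm i θ x :=
  Real.iSup_nonneg fun t => mul_nonneg (Real.rpow_nonneg (le_of_lt t.2) _)
    (kFun_nonneg i (le_of_lt t.2) x)

variable {i} {θ : ℝ}

theorem kFun_le_interpNorm (hθ : 0 ≤ θ) {x : E₀} (hx : x ∈ interpSpace i θ) {t : ℝ} (ht : 0 < t) :
    kFun i t x ≤ t ^ θ * interpNorm i θ x := by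
  have h := le_ciSup (bddAbove_interpNorm i hθ hx) ⟨t, ht⟩
  have h2 : t ^ (-θ) * kFun i t x ≤ interpNorm i θ x := h
  rw [Real.rpow_neg ht.le, inv_mul_le_iff₀ (Real.rpow_pos_of_pos ht θ)] at h2
  exact h2

theorem interpNorm_le {x : E₀} {M : ℝ} (h : ∀ t > 0, kFun i t x ≤ t ^ θ * M) :
    interpNorm i θ x ≤ M := by
  have : Nonempty (Ioi (0 : ℝ)) := ⟨⟨1, mem_Ioi.2 one_pos⟩⟩
  refine ciSup_le fun ⟨t, ht⟩ => ?_
  have ht' : (0 : ℝ) < t := ht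
  rw [Real.rpow_neg ht'.le, inv_mul_le_iff₀ (Real.rpow_pos_of_pos ht' θ)]
  exact h t ht

theorem mem_interpSpace_iff {x : E₀} :
    x ∈ interpSpace i θ ↔ ∀ ε > 0, ∃ δ > 0, ∀ t, 0 < t → t ≤ δ → kFun i t x ≤ t ^ θ * ε := by
  constructor
  · intro hx ε hε
    have h1 : ∀ᶠ t in 𝓝[>] (0 : ℝ), t ^ (-θ) * kFun i t x < ε :=
      (show Tendsto _ _ _ from hx).eventually (gt_mem_nhds hε)
    obtain ⟨δ, hδ, hδ'⟩ := mem_nhdsGT_iff_exists_Ioc_subset.1 h1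
    refine ⟨δ, hδ, fun t ht htδ => ?_⟩
    have h2 : t ^ (-θ) * kFun i t x < ε := hδ' ⟨ht, htδ⟩
    rw [Real.rpow_neg ht.le, inv_mul_lt_iff₀ (Real.rpow_pos_of_pos ht θ)] at h2
    exact h2.le
  · intro h
    refine tendsto_order.2 ⟨fun a ha => ?_, fun a ha => ?_⟩
    · filter_upwards [self_mem_nhdsWithin] with t ht
      exact ha.trans_le (mul_nonneg (Real.rpow_nonneg (le_of_lt ht) _)
        (kFun_nonneg i (le_of_lt ht) x))
    · obtain ⟨δ, hδ, H⟩ := h (a / 2) (half_pos ha)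
      filter_upwards [Ioc_mem_nhdsGT hδ] with t ht
      have h2 := H t ht.1 ht.2
      rw [Real.rpow_neg ht.1.le, inv_mul_lt_iff₀ (Real.rpow_pos_of_pos ht.1 θ)]
      have := mul_lt_mul_of_pos_left (half_lt_self ha) (Real.rpow_pos_of_pos ht.1 θ)
      linarith

theorem zero_mem_interpSpace : (0 : E₀) ∈ interpSpace i θ := by
  refine mem_interpSpace_iff.2 fun ε hε => ⟨1, one_pos, fun t ht _ => ?_⟩
  rw [kFun_zero i ht.le]
  positivity

theorem add_mem_interpSpace {x y : E₀} (hx : x ∈ interpSpace i θ) (hy : y ∈ interpSpace i θ) :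
    x + y ∈ interpSpace i θ := by
  refine mem_interpSpace_iff.2 fun ε hε => ?_
  obtain ⟨δ₁, h₁, H₁⟩ := mem_interpSpace_iff.1 hx (ε / 2) (half_pos hε)
  obtain ⟨δ₂, h₂, H₂⟩ := mem_interpSpace_iff.1 hy (ε / 2) (half_pos hε)
  refine ⟨min δ₁ δ₂, lt_min h₁ h₂, fun t ht h => ?_⟩
  have a := H₁ t ht (h.trans (min_le_left _ _))
  have b := H₂ t ht (h.trans (min_le_right _ _))
  have c := kFun_add_le i ht.le x y
  linarith

theorem neg_mem_interpSpace {x : E₀} (hx : x ∈ interpSpace i θ) : -x ∈ interpSpace i θ := by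
  simpa only [mem_interpSpace_iff, kFun_neg] using hx

theorem sub_mem_interpSpace {x y : E₀} (hx : x ∈ interpSpace i θ) (hy : y ∈ interpSpace i θ) :
    x - y ∈ interpSpace i θ := by
  simpa [sub_eq_add_neg] using add_mem_interpSpace hx (neg_mem_interpSpace hy)

theorem interpNorm_zero : interpNorm i θ (0 : E₀) = 0 :=
  le_antisymm (interpNorm_le fun t ht => by rw [kFun_zero i ht.le]; simp) (interpNorm_nonneg _ _ _)

theorem interpNorm_neg (x : E₀) : interpNorm i θ (-x) = interpNorm i θ x := by
  simp only [interpNorm, kFun_neg]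

theorem interpNorm_sub_comm (x y : E₀) : interpNorm i θ (x - y) = interpNorm i θ (y - x) := by
  rw [← interpNorm_neg, neg_sub]

theorem interpNorm_add_le (hθ : 0 ≤ θ) {x y : E₀} (hx : x ∈ interpSpace i θ)
    (hy : y ∈ interpSpace i θ) :
    interpNorm i θ (x + y) ≤ interpNorm i θ x + interpNorm i θ y := by
  refine interpNorm_le fun t ht => ?_
  have a := kFun_le_interpNorm hθ hx ht
  have b := kFun_le_interpNorm hθ hy ht
  have c := kFun_add_le i ht.le x y
  linarith

theorem interpNorm_sub_le_sub_add_sub (hθ : 0 ≤ θ) {x y z : E₀} (hx : x ∈ interpSpace i θ)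
    (hy : y ∈ interpSpace i θ) (hz : z ∈ interpSpace i θ) :
    interpNorm i θ (x - z) ≤ interpNorm i θ (x - y) + interpNorm i θ (y - z) := by
  simpa using interpNorm_add_le hθ (sub_mem_interpSpace hx hy) (sub_mem_interpSpace hy hz)

theorem norm_le_interpNorm (hθ : 0 ≤ θ) {x : E₀} (hx : x ∈ interpSpace i θ) :
    ‖x‖ ≤ (1 + ‖i‖) * interpNorm i θ x := by
  refine (norm_le_kFun_one i x).trans ?_
  have := kFun_le_interpNorm hθ hx one_pos
  rw [Real.one_rpow, one_mul] at this
  gcongr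

theorem interpSpace_anti {θ' : ℝ} (h : θ ≤ θ') : interpSpace i θ' ⊆ interpSpace i θ := by
  intro x hx
  refine mem_interpSpace_iff.2 fun ε hε => ?_
  obtain ⟨δ, h₁, H⟩ := mem_interpSpace_iff.1 hx ε hε
  refine ⟨min δ 1, lt_min h₁ one_pos, fun t ht htδ => ?_⟩
  refine (H t ht (htδ.trans (min_le_left _ _))).trans ?_
  gcongr ?_ * _
  exact Real.rpow_le_rpow_of_exponent_ge ht (htδ.trans (min_le_right _ _)) h

/-- For t ≤ 1 the larger exponent gives the smaller power; for t ≥ 1 the bound K ≤ |x|_{E₀} suffices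
because t^θ ≥ 1. -/
theorem interpNorm_le_of_le {θ' : ℝ} (hθ : 0 ≤ θ) (h : θ ≤ θ') {x : E₀}
    (hx : x ∈ interpSpace i θ') :
    interpNorm i θ x ≤ (1 + ‖i‖) * interpNorm i θ' x := by
  have hN := interpNorm_nonneg i θ' x
  refine interpNorm_le fun t ht => ?_
  rcases le_total t 1 with h1 | h1
  · refine (kFun_le_interpNorm (hθ.trans h) hx ht).trans ?_
    have a := Real.rpow_le_rpow_of_exponent_ge ht h1 h
    have b : interpNorm i θ' x ≤ (1 + ‖i‖) * interpNorm i θ' x := by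
      nlinarith [norm_nonneg i, mul_nonneg (norm_nonneg i) hN]
    gcongr
  · refine (kFun_le_norm i ht.le x).trans ((norm_le_interpNorm (hθ.trans h) hx).trans ?_)
    exact le_mul_of_one_le_left (by positivity) (Real.one_le_rpow h1 hθ)

theorem apply_mem_interpSpace (hθ : θ < 1) (b : E₁) : i b ∈ interpSpace i θ := by
  refine mem_interpSpace_iff.2 fun ε hε => ?_
  have hc : (0 : ℝ) < ‖b‖ + 1 := by positivity
  have : Tendsto (fun t : ℝ => t ^ (1 - θ) * ‖b‖) (𝓝[>] 0) (𝓝 0) := by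
    have h : ContinuousAt (fun t : ℝ => t ^ (1 - θ) * ‖b‖) 0 :=
      (Real.continuousAt_rpow_const _ _ (Or.inr (by linarith))).mul continuousAt_const
    have h2 := h.tendsto
    simp only [Real.zero_rpow (show (1 - θ) ≠ 0 by linarith), zero_mul] at h2
    exact h2.mono_left nhdsWithin_le_nhds
  obtain ⟨δ, hδ, H⟩ := mem_nhdsGT_iff_exists_Ioc_subset.1 (this.eventually (gt_mem_nhds hε))
  refine ⟨δ, hδ, fun t ht htδ => (kFun_apply_le i ht.le b).trans ?_⟩
  have h3 : t ^ (1 - θ) * ‖b‖ < ε := H ⟨ht, htδ⟩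
  have h4 : t * ‖b‖ = t ^ θ * (t ^ (1 - θ) * ‖b‖) := by
    rw [← mul_assoc, ← Real.rpow_add ht]; simp
  rw [h4]
  gcongr

theorem interpNorm_apply_le (h0 : 0 ≤ θ) (h1 : θ ≤ 1) (b : E₁) :
    interpNorm i θ (i b) ≤ (1 + ‖i‖) * ‖b‖ := by
  refine interpNorm_le fun t ht => ?_
  rcases le_total t 1 with h | h
  · refine (kFun_apply_le i ht.le b).trans ?_
    have a : t ≤ t ^ θ := by
      simpa using Real.rpow_le_rpow_of_exponent_ge ht h h1
    have : ‖b‖ ≤ (1 + ‖i‖) * ‖b‖ :=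
      le_mul_of_one_le_left (norm_nonneg b) (le_add_of_nonneg_right (norm_nonneg i))
    gcongr
  · refine (kFun_le_norm i ht.le _).trans ((i.le_opNorm b).trans ?_)
    refine le_trans ?_ (le_mul_of_one_le_left (by positivity) (Real.one_le_rpow h h0))
    nlinarith [norm_nonneg b]

/-- The interpolation inequality between `E_μ` and `E₁`. -/
theorem interpNorm_apply_le_rpow_mul {μ : ℝ} (hμ : 0 ≤ μ) (hμθ : μ ≤ θ) (hμ1 : μ < 1)
    (hθ1 : θ ≤ 1) (b : E₁) :
    interpNorm i θ (i b) ≤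
      interpNorm i μ (i b) ^ ((1 - θ) / (1 - μ)) * ‖b‖ ^ ((θ - μ) / (1 - μ)) := by
  have hd : 0 < 1 - μ := by linarith
  have hN := interpNorm_nonneg i μ (i b)
  refine interpNorm_le fun t ht => ?_
  -- K(t, i b) is at most t^μ |i b|_{E_μ} and at most t‖b‖; take the geometric mean of the two
  -- bounds with weights p + q = 1, for which μp + q = θ.
  set p := (1 - θ) / (1 - μ) with hp
  set q := (θ - μ) / (1 - μ) with hq
  have hp0 : 0 ≤ p := div_nonneg (by linarith) hd.le
  have hq0 : 0 ≤ q := div_nonneg (by linarith) hd.le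
  have hpq : p + q = 1 := by rw [hp, hq]; field_simp; ring
  have hk := kFun_nonneg i ht.le (i b)
  have h1 := kFun_le_interpNorm (i := i) hμ (apply_mem_interpSpace hμ1 b) ht
  have h2 := kFun_apply_le i ht.le b
  calc kFun i t (i b) = kFun i t (i b) ^ p * kFun i t (i b) ^ q := by
        rw [← Real.rpow_add_of_nonneg hk hp0 hq0, hpq, Real.rpow_one]
    _ ≤ (t ^ μ * interpNorm i μ (i b)) ^ p * (t * ‖b‖) ^ q := by gcongr
    _ = t ^ (μ * p + q) * (interpNorm i μ (i b) ^ p * ‖b‖ ^ q) := by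
        rw [Real.mul_rpow (by positivity) hN, Real.mul_rpow ht.le (norm_nonneg b),
          Real.rpow_add ht, Real.rpow_mul ht.le]
        ring
    _ = _ := by
        congr 2
        rw [hp, hq]; field_simp; ring

end Interpolation

/-! ### Weighted functions BC_{1-μ} -/

section Weighted

open MeasureTheory

variable {E F : Type*} [NormedAddCommGroup E] [NormedAddCommGroup F] {μ ν T : ℝ}

theorem MemBC.exists_le {f : ℝ → E} (hf : MemBC μ T f) {ε : ℝ} (hε : 0 < ε) :
    ∃ δ > 0, ∀ t, 0 < t → t ≤ δ → t ^ (1 - μ) * ‖f t‖ ≤ ε := by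
  obtain ⟨δ, hδ, H⟩ :=
    mem_nhdsGT_iff_exists_Ioc_subset.1 (hf.tendsto_zero.eventually (gt_mem_nhds hε))
  exact ⟨δ, hδ, fun t h1 h2 => (le_of_lt (H ⟨h1, h2⟩ : t ^ (1 - μ) * ‖f t‖ < ε))⟩

theorem tendsto_nhdsGT_zero_of_forall_le {φ : ℝ → ℝ} (h0 : ∀ t > 0, 0 ≤ φ t)
    (h : ∀ ε > 0, ∃ δ > 0, ∀ t, 0 < t → t ≤ δ → φ t ≤ ε) : Tendsto φ (𝓝[>] 0) (𝓝 0) := by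
  refine tendsto_order.2 ⟨fun a ha => ?_, fun a ha => ?_⟩
  · filter_upwards [self_mem_nhdsWithin] with t ht
    exact ha.trans_le (h0 t ht)
  · obtain ⟨δ, hδ, H⟩ := h (a / 2) (half_pos ha)
    filter_upwards [Ioc_mem_nhdsGT hδ] with t ht
    linarith [H t ht.1 ht.2]

/-- Boundedness in the definition of `BC_{1-μ}` follows from continuity and the decay at `0`. -/
theorem memBC_of_tendsto {f : ℝ → E} (hf : ContinuousOn f (Ioc 0 T))
    (h : Tendsto (fun t : ℝ => t ^ (1 - μ) * ‖f t‖) (𝓝[>] 0) (𝓝 0)) : MemBC μ T f := by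
  refine ⟨hf, ?_, h⟩
  obtain ⟨δ, hδ, H⟩ :=
    mem_nhdsGT_iff_exists_Ioc_subset.1 (h.eventually (gt_mem_nhds one_pos))
  have hδ' : (0 : ℝ) < δ := hδ
  have hc : ContinuousOn (fun t : ℝ => t ^ (1 - μ) * ‖f t‖) (Icc δ T) := by
    refine ContinuousOn.mul (fun t ht => ?_) (hf.mono fun _ ht => ⟨hδ'.trans_le ht.1, ht.2⟩).norm
    exact (Real.continuousAt_rpow_const _ _
      (Or.inl (hδ'.trans_le ht.1).ne')).continuousWithinAt
  obtain ⟨C, hC⟩ := isCompact_Icc.exists_bound_of_continuousOn hc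
  refine ⟨max 1 C, fun t ht => ?_⟩
  rcases le_total t δ with h1 | h1
  · exact le_max_of_le_left (le_of_lt (H ⟨ht.1, h1⟩))
  · exact le_max_of_le_right ((le_abs_self _).trans (hC t ⟨h1, ht.2⟩))

theorem memBC_of_forall_le {f : ℝ → E} (hf : ContinuousOn f (Ioc 0 T))
    (h : ∀ ε > 0, ∃ δ > 0, ∀ t, 0 < t → t ≤ δ → t ^ (1 - μ) * ‖f t‖ ≤ ε) : MemBC μ T f :=
  memBC_of_tendsto hf (tendsto_nhdsGT_zero_of_forall_le
    (fun _ ht => mul_nonneg (Real.rpow_nonneg (le_of_lt ht) _) (norm_nonneg _)) h)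

theorem tendsto_rpow_nhdsGT_zero {p : ℝ} (hp : 0 < p) :
    Tendsto (fun t : ℝ => t ^ p) (𝓝[>] 0) (𝓝 0) := by
  have h := (Real.continuousAt_rpow_const 0 p (Or.inr hp.le)).tendsto
  rw [Real.zero_rpow hp.ne'] at h
  exact h.mono_left nhdsWithin_le_nhds

theorem memBC_of_continuousOn_Icc {f : ℝ → E} (hμ : μ < 1) (hT : 0 < T)
    (hf : ContinuousOn f (Icc 0 T)) : MemBC μ T f := by
  refine memBC_of_tendsto (hf.mono Ioc_subset_Icc_self) ?_
  have h1 : Tendsto f (𝓝[>] 0) (𝓝 (f 0)) := by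
    have := hf 0 ⟨le_rfl, hT.le⟩
    refine this.mono_left ?_
    rw [← nhdsWithin_Ioc_eq_nhdsGT hT]
    exact nhdsWithin_mono _ Ioc_subset_Icc_self
  simpa using (tendsto_rpow_nhdsGT_zero (sub_pos.2 hμ)).mul h1.norm

theorem MemBC.mono_right {f : ℝ → E} (hf : MemBC μ T f) {T' : ℝ} (h : T' ≤ T) : MemBC μ T' f :=
  ⟨hf.1.mono (Ioc_subset_Ioc_right h), hf.2.imp fun _ hC t ht => hC t ⟨ht.1, ht.2.trans h⟩, hf.3⟩

/-- Write t^(1−μ) = t^(ν−μ) t^(1−ν). The gain T^(ν−μ) is what later carries the linear estimate from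
weight μ to weight ν. -/
theorem rpow_weight_le {t : ℝ} (ht : 0 < t) (h1 : t ≤ T) (hμν : μ ≤ ν) (a : E) :
    t ^ (1 - μ) * ‖a‖ ≤ T ^ (ν - μ) * (t ^ (1 - ν) * ‖a‖) := by
  have : t ^ (1 - μ) = t ^ (ν - μ) * t ^ (1 - ν) := by
    rw [← Real.rpow_add ht]; congr 1; ring
  rw [this, mul_assoc]
  gcongr

theorem MemBC.anti_weight {f : ℝ → E} (hf : MemBC ν T f) (hμν : μ ≤ ν) : MemBC μ T f := by
  refine memBC_of_forall_le hf.1 fun ε hε => ?_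
  obtain ⟨δ, hδ, H⟩ := hf.exists_le hε
  refine ⟨min δ 1, lt_min hδ one_pos, fun t ht h => ?_⟩
  have := rpow_weight_le ht (h.trans (min_le_right _ _)) hμν (f t)
  rw [Real.one_rpow, one_mul] at this
  exact this.trans (H t ht (h.trans (min_le_left _ _)))

theorem MemBC.congr {f g : ℝ → E} (hf : MemBC μ T f) (hT : 0 < T) (h : EqOn g f (Ioc 0 T)) :
    MemBC μ T g := by
  refine ⟨hf.1.congr h, hf.2.imp fun C hC t ht => by rw [h ht]; exact hC t ht, ?_⟩
  refine hf.3.congr' ?_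
  filter_upwards [Ioc_mem_nhdsGT hT] with t ht
  rw [h ht]

theorem MemBC.add {f g : ℝ → E} (hf : MemBC μ T f) (hg : MemBC μ T g) :
    MemBC μ T (fun t => f t + g t) := by
  refine memBC_of_forall_le (hf.1.add hg.1) fun ε hε => ?_
  obtain ⟨δ, hδ, H⟩ := hf.exists_le (half_pos hε)
  obtain ⟨δ', hδ', H'⟩ := hg.exists_le (half_pos hε)
  refine ⟨min δ δ', lt_min hδ hδ', fun t ht h => ?_⟩
  have a := H t ht (h.trans (min_le_left _ _))
  have b := H' t ht (h.trans (min_le_right _ _))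
  calc _ ≤ t ^ (1 - μ) * (‖f t‖ + ‖g t‖) := by gcongr; exact norm_add_le _ _
    _ ≤ ε := by rw [mul_add]; linarith

theorem MemBC.neg {f : ℝ → E} (hf : MemBC μ T f) : MemBC μ T (fun t => -f t) :=
  ⟨hf.1.neg, by simpa using hf.2, by simpa using hf.3⟩

theorem MemBC.sub {f g : ℝ → E} (hf : MemBC μ T f) (hg : MemBC μ T g) :
    MemBC μ T (fun t => f t - g t) := by
  simpa [sub_eq_add_neg] using hf.add hg.neg

theorem memBC_zero : MemBC μ T (fun _ => (0 : E)) :=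
  ⟨continuousOn_const, ⟨0, fun _ _ => by simp⟩, by simp⟩

theorem norm_le_rpow_of_weight_le {a : E} {t M : ℝ} (ht : 0 < t) (h : t ^ (1 - μ) * ‖a‖ ≤ M) :
    ‖a‖ ≤ M * t ^ (μ - 1) := by
  have h2 : t ^ (μ - 1) = (t ^ (1 - μ))⁻¹ := by rw [← Real.rpow_neg ht.le]; congr 1; ring
  rw [h2, ← div_eq_mul_inv, le_div_iff₀ (Real.rpow_pos_of_pos ht _)]
  linarith

/-- Away from the origin there is no singularity: the restarted function is continuous up to its new
initial time, so any weight ν < 1 is allowed. -/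
theorem MemBC.shift {f : ℝ → E} (hf : MemBC μ T f) (hν : ν < 1) {s : ℝ} (hs : 0 < s) (hsT : s < T) :
    MemBC ν (T - s) (fun t => f (t + s)) := by
  refine memBC_of_continuousOn_Icc hν (by linarith) ?_
  refine hf.1.comp (by fun_prop) fun t ht => ⟨by linarith [ht.1], by linarith [ht.2]⟩


/-- The weight bounds the function by C s^(μ−1), integrable at 0 because μ > 0. -/
theorem MemBC.intervalIntegrable {f : ℝ → E} (hμ : 0 < μ) (hf : MemBC μ T f) {s t : ℝ}
    (hs : 0 ≤ s) (hs' : s ≤ T) (ht : 0 ≤ t) (htT : t ≤ T) :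
    IntervalIntegrable f volume s t := by
  have key : ∀ r, 0 ≤ r → r ≤ T → IntervalIntegrable f volume 0 r := by
    intro r hr hrT
    obtain ⟨C, hC⟩ := hf.2
    rw [intervalIntegrable_iff_integrableOn_Ioc_of_le hr]
    have h1 : IntegrableOn (fun s : ℝ => C * s ^ (μ - 1)) (Ioc 0 r) volume := by
      rw [← intervalIntegrable_iff_integrableOn_Ioc_of_le hr]
      exact (intervalIntegral.intervalIntegrable_rpow' (by linarith)).const_mul C
    refine h1.mono' ((hf.1.mono (Ioc_subset_Ioc_right hrT)).aestronglyMeasurable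
      measurableSet_Ioc) ?_
    refine (ae_restrict_iff' measurableSet_Ioc).2 (Eventually.of_forall fun s hs => ?_)
    exact norm_le_rpow_of_weight_le hs.1 (hC s ⟨hs.1, hs.2.trans hrT⟩)
  exact (key s hs hs').symm.trans (key t ht htT)

variable [NormedSpace ℝ E] [NormedSpace ℝ F]

theorem MemBC.const_smul {f : ℝ → E} (hf : MemBC μ T f) (c : ℝ) : MemBC μ T (fun t => c • f t) := by
  refine memBC_of_tendsto (hf.1.const_smul c) ?_
  have := hf.3.const_mul |c|
  rw [mul_zero] at this
  refine this.congr fun t => ?_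
  rw [norm_smul, Real.norm_eq_abs]; ring

theorem MemBC.clm {f : ℝ → E} (hf : MemBC μ T f) (L : E →L[ℝ] F) :
    MemBC μ T (fun t => L (f t)) := by
  refine memBC_of_tendsto (L.continuous.comp_continuousOn hf.1) ?_
  have := hf.3.const_mul ‖L‖
  rw [mul_zero] at this
  refine tendsto_of_tendsto_of_tendsto_of_le_of_le' tendsto_const_nhds this ?_ ?_
  · filter_upwards [self_mem_nhdsWithin] with t ht
    exact mul_nonneg (Real.rpow_nonneg (le_of_lt ht) _) (norm_nonneg _)
  · filter_upwards [self_mem_nhdsWithin] with t ht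
    have := mul_le_mul_of_nonneg_left (L.le_opNorm (f t))
      (Real.rpow_nonneg (le_of_lt ht) (1 - μ))
    linarith

theorem norm_integral_le_of_weight_le {f : ℝ → E} (hμ : 0 < μ) {t M : ℝ} (ht : 0 ≤ t)
    (h : ∀ s ∈ Ioc 0 t, s ^ (1 - μ) * ‖f s‖ ≤ M) : ‖∫ s in (0 : ℝ)..t, f s‖ ≤ M * t ^ μ / μ := by
  have h1 : IntervalIntegrable (fun s : ℝ => M * s ^ (μ - 1)) volume 0 t :=
    (intervalIntegral.intervalIntegrable_rpow' (by linarith)).const_mul M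
  refine (intervalIntegral.norm_integral_le_of_norm_le ht
    (Eventually.of_forall fun s hs => norm_le_rpow_of_weight_le hs.1 (h s hs)) h1).trans ?_
  rw [intervalIntegral.integral_const_mul, integral_rpow (Or.inl (by linarith))]
  simp [Real.zero_rpow hμ.ne', mul_div_assoc]

end Weighted

/-! ### The space 𝔼_{1,ν} in integrated form -/

section Primitive

open MeasureTheory

variable {E₀ E₁ : Type*} [NormedAddCommGroup E₀] [NormedSpace ℝ E₀]
  [NormedAddCommGroup E₁] [NormedSpace ℝ E₁]

/-- `v ∈ 𝔼_{1,ν}([0,T])` with trace `x` and time derivative `g`, in integrated form. -/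
structure IsPrimitive (i : E₁ →L[ℝ] E₀) (ν T : ℝ) (x : E₀) (v : ℝ → E₁) (g : ℝ → E₀) : Prop where
  memBC : MemBC ν T v
  memBC_deriv : MemBC ν T g
  integral_eq : ∀ t ∈ Ioc (0 : ℝ) T, i (v t) = x + ∫ s in (0 : ℝ)..t, g s

variable {i : E₁ →L[ℝ] E₀} {μ ν T : ℝ} {x y : E₀} {v w : ℝ → E₁} {g h : ℝ → E₀}

theorem IsPrimitive.mono_right (H : IsPrimitive i ν T x v g) {T' : ℝ} (h : T' ≤ T) :
    IsPrimitive i ν T' x v g :=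
  ⟨H.1.mono_right h, H.2.mono_right h, fun t ht => H.3 t ⟨ht.1, ht.2.trans h⟩⟩

theorem IsPrimitive.anti_weight (H : IsPrimitive i ν T x v g) (h : μ ≤ ν) :
    IsPrimitive i μ T x v g :=
  ⟨H.1.anti_weight h, H.2.anti_weight h, H.3⟩

theorem IsPrimitive.congr (H : IsPrimitive i ν T x v g) (hT : 0 < T) (hv : EqOn w v (Ioc 0 T))
    (hg : EqOn h g (Ioc 0 T)) : IsPrimitive i ν T x w h := by
  refine ⟨H.1.congr hT hv, H.2.congr hT hg, fun t ht => ?_⟩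
  rw [hv ht, H.3 t ht]
  congr 1
  refine intervalIntegral.integral_congr_ae (Eventually.of_forall fun s hs => ?_)
  rw [uIoc_of_le ht.1.le] at hs
  exact (hg ⟨hs.1, hs.2.trans ht.2⟩).symm

theorem IsPrimitive.add (hν : 0 < ν) (H : IsPrimitive i ν T x v g) (H' : IsPrimitive i ν T y w h) :
    IsPrimitive i ν T (x + y) (fun t => v t + w t) (fun t => g t + h t) := by
  refine ⟨H.1.add H'.1, H.2.add H'.2, fun t ht => ?_⟩
  have hT : 0 ≤ T := ht.1.le.trans ht.2
  rw [intervalIntegral.integral_add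
    (H.2.intervalIntegrable hν le_rfl hT ht.1.le ht.2)
    (H'.2.intervalIntegrable hν le_rfl hT ht.1.le ht.2), map_add, H.3 t ht, H'.3 t ht]
  abel

theorem IsPrimitive.const_smul (H : IsPrimitive i ν T x v g) (c : ℝ) :
    IsPrimitive i ν T (c • x) (fun t => c • v t) (fun t => c • g t) := by
  refine ⟨H.1.const_smul c, H.2.const_smul c, fun t ht => ?_⟩
  rw [intervalIntegral.integral_smul, map_smul, H.3 t ht, smul_add]

theorem IsPrimitive.sub (hν : 0 < ν) (H : IsPrimitive i ν T x v g) (H' : IsPrimitive i ν T y w h) :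
    IsPrimitive i ν T (x - y) (fun t => v t - w t) (fun t => g t - h t) := by
  simpa [sub_eq_add_neg] using H.add hν (H'.const_smul (-1))

theorem IsPrimitive.shift (hν : 0 < ν) (hμ : μ < 1) (H : IsPrimitive i ν T x v g) {s : ℝ}
    (hs : 0 < s) (hsT : s < T) :
    IsPrimitive i μ (T - s) (i (v s)) (fun t => v (t + s)) (fun t => g (t + s)) := by
  refine ⟨H.1.shift hμ hs hsT, H.2.shift hμ hs hsT, fun t ht => ?_⟩
  have hT : 0 ≤ T := (hs.trans hsT).le
  have h2 : t + s ≤ T := by linarith [ht.2]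
  have h1 : 0 < t + s := by linarith [ht.1]
  rw [H.3 (t + s) ⟨h1, h2⟩, H.3 s ⟨hs, hsT.le⟩,
    intervalIntegral.integral_comp_add_right (fun r => g r) s, zero_add, add_assoc,
    intervalIntegral.integral_add_adjacent_intervals
    (H.2.intervalIntegrable hν le_rfl hT hs.le hsT.le)
    (H.2.intervalIntegrable hν hs.le hsT.le h1.le h2)]

theorem IsPrimitive.norm_sub_le (hν : 0 < ν) (H : IsPrimitive i ν T x v g) {t M : ℝ}
    (ht : t ∈ Ioc 0 T) (hM : ∀ s ∈ Ioc 0 t, s ^ (1 - ν) * ‖g s‖ ≤ M) :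
    ‖i (v t) - x‖ ≤ M * t ^ ν / ν := by
  rw [H.3 t ht, add_sub_cancel_left]
  exact norm_integral_le_of_weight_le hν ht.1.le hM

theorem IsPrimitive.hasTrace (hν : 0 < ν) (hT : 0 < T) (H : IsPrimitive i ν T x v g) :
    HasTrace i v x := by
  obtain ⟨C, hC⟩ := H.2.2
  refine tendsto_iff_norm_sub_tendsto_zero.2 ?_
  have h1 : Tendsto (fun t : ℝ => C * t ^ ν / ν) (𝓝[>] 0) (𝓝 0) := by
    simpa using ((tendsto_rpow_nhdsGT_zero hν).const_mul C).div_const ν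
  refine tendsto_of_tendsto_of_tendsto_of_le_of_le' tendsto_const_nhds h1
    (Eventually.of_forall fun t => norm_nonneg _) ?_
  filter_upwards [Ioc_mem_nhdsGT hT] with t ht
  exact H.norm_sub_le hν ht fun s hs => hC s ⟨hs.1, hs.2.trans ht.2⟩

variable [CompleteSpace E₀]

theorem MemBC.hasDerivWithinAt_integral {E : Type*} [NormedAddCommGroup E] [NormedSpace ℝ E]
    [CompleteSpace E] {f : ℝ → E} (hν : 0 < ν) (hf : MemBC ν T f) {t : ℝ}
    (ht : t ∈ Ioc 0 T) :
    HasDerivWithinAt (fun r => ∫ s in (0 : ℝ)..r, f s) (f t) (Ioc 0 T) t := by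
  have hT : 0 ≤ T := ht.1.le.trans ht.2
  have ht2 : t / 2 < t := half_lt_self ht.1
  -- The `Fact` selects the one-sided version of the fundamental theorem within [t/2, T], which
  -- avoids the singular point 0 and is a neighbourhood of t within (0, T].
  have : Fact (t ∈ Icc (t / 2) T) := ⟨⟨ht2.le, ht.2⟩⟩
  have hsub : Icc (t / 2) T ⊆ Ioc 0 T := fun s hs => ⟨by linarith [hs.1, ht.1], hs.2⟩
  have hc : ContinuousOn f (Icc (t / 2) T) := hf.1.mono hsub
  have h1 : HasDerivWithinAt (fun r => ∫ s in (0 : ℝ)..r, f s) (f t) (Icc (t / 2) T) t :=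
    intervalIntegral.integral_hasDerivWithinAt_right
      (hf.intervalIntegrable hν le_rfl hT ht.1.le ht.2)
      (hc.stronglyMeasurableAtFilter_nhdsWithin measurableSet_Icc t) (hc t this.out)
  refine h1.mono_of_mem_nhdsWithin ?_
  filter_upwards [self_mem_nhdsWithin, mem_nhdsWithin_of_mem_nhds (Ioi_mem_nhds ht2)] with s hs hs'
  exact ⟨le_of_lt hs', hs.2⟩

theorem IsPrimitive.hasDerivWithinAt (hν : 0 < ν) (H : IsPrimitive i ν T x v g) {t : ℝ}
    (ht : t ∈ Ioc 0 T) : HasDerivWithinAt (fun s => i (v s)) (g t) (Ioc 0 T) t :=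
  ((H.2.hasDerivWithinAt_integral hν ht).const_add x).congr (fun s hs => H.3 s hs) (H.3 t ht)

theorem IsPrimitive.timeDeriv_eq (hν : 0 < ν) (H : IsPrimitive i ν T x v g) :
    EqOn (timeDeriv i T v) g (Ioc 0 T) := fun t ht =>
  (H.hasDerivWithinAt hν ht).derivWithin (uniqueDiffOn_Ioc 0 T t ht)

theorem IsPrimitive.memE1 (hν : 0 < ν) (hT : 0 < T) (H : IsPrimitive i ν T x v g) :
    MemE1 i ν T v :=
  ⟨fun _ ht => (H.hasDerivWithinAt hν ht).differentiableWithinAt, H.1.clm i,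
    H.2.congr hT (H.timeDeriv_eq hν), H.1⟩

/-- The fundamental theorem of calculus needs only a limit at 0 once the derivative is integrable
there. -/
theorem isPrimitive_of_hasDerivWithinAt (hν : 0 < ν) (hv : MemBC ν T v) (hg : MemBC ν T g)
    (hd : ∀ s ∈ Ioc 0 T, HasDerivWithinAt (fun s => i (v s)) (g s) (Ioc 0 T) s)
    (hx : HasTrace i v x) : IsPrimitive i ν T x v g := by
  refine ⟨hv, hg, fun t ht => ?_⟩
  have := intervalIntegral.integral_eq_sub_of_hasDerivAt_of_tendsto ht.1
    (fun s hs => (hd s ⟨hs.1, hs.2.le.trans ht.2⟩).hasDerivAt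
      (Ioc_mem_nhds hs.1 (hs.2.trans_le ht.2)))
    (hg.intervalIntegrable hν le_rfl (ht.1.le.trans ht.2) ht.1.le ht.2) hx
    (fb := i (v t)) ?_
  · rw [this]; abel
  · refine ((hd t ht).continuousWithinAt.tendsto).mono_left ?_
    rw [← nhdsWithin_Ioo_eq_nhdsLT ht.1]
    exact nhdsWithin_mono _ fun s hs => ⟨hs.1, hs.2.le.trans ht.2⟩

theorem MemE1.isPrimitive (hν : 0 < ν) (H : MemE1 i ν T v) (hx : HasTrace i v x) :
    IsPrimitive i ν T x v (timeDeriv i T v) :=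
  isPrimitive_of_hasDerivWithinAt hν H.4 H.3 (fun s hs => (H.1 s hs).hasDerivWithinAt) hx

end Primitive

/-! ### Traces of 𝔼_{1,ν} at t = 0 -/

section Trace

variable {E₀ E₁ : Type*} [NormedAddCommGroup E₀] [NormedSpace ℝ E₀]
  [NormedAddCommGroup E₁] [NormedSpace ℝ E₁]
  {i : E₁ →L[ℝ] E₀} {ν T : ℝ} {x : E₀} {v : ℝ → E₁} {g : ℝ → E₀}

/-- The trace space of `𝔼_{1,ν}` is contained in `E_ν`. -/
theorem IsPrimitive.mem_interpSpace (hν : 0 < ν) (hT : 0 < T)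
    (H : IsPrimitive i ν T x v g) : x ∈ interpSpace i ν := by
  refine mem_interpSpace_iff.2 fun ε hε => ?_
  -- The two parts of x = (x − i v(t)) + i v(t) contribute η/ν and η, each times t^ν.
  set η := ε / (1 / ν + 1) with hη
  have hη0 : 0 < η := by positivity
  obtain ⟨δ, hδ, H1⟩ := H.1.exists_le hη0
  obtain ⟨δ', hδ', H2⟩ := H.2.exists_le hη0
  refine ⟨min T (min δ δ'), lt_min hT (lt_min hδ hδ'), fun t ht h => ?_⟩
  have hδt := (h.trans (min_le_right _ _)).trans (min_le_left _ _)
  have hδt' := (h.trans (min_le_right _ _)).trans (min_le_right _ _)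
  have a := H.norm_sub_le hν ⟨ht, h.trans (min_le_left _ _)⟩
    (fun s hs => H2 s hs.1 (hs.2.trans hδt'))
  have b := norm_le_rpow_of_weight_le ht (H1 t ht hδt)
  have c : t * t ^ (ν - 1) = t ^ ν := by
    rw [Real.rpow_sub_one ht.ne']; field_simp
  have e : ε = η / ν + η := by rw [hη]; field_simp
  calc kFun i t x ≤ ‖x - i (v t)‖ + t * ‖v t‖ := kFun_le i ht.le x (v t)
    _ ≤ η * t ^ ν / ν + t * (η * t ^ (ν - 1)) := by
        rw [norm_sub_rev]; gcongr
    _ = η * t ^ ν / ν + η * (t * t ^ (ν - 1)) := by ring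
    _ = t ^ ν * ε := by rw [c, e]; ring

/-- The embedding of `𝔼_{1,ν}([0,T])` into `C([0,T], E_ν)`, with constant independent of `T`. -/
theorem IsPrimitive.interpNorm_sub_le (hν : 0 < ν) (hν1 : ν < 1) (H : IsPrimitive i ν T x v g)
    {t M : ℝ} (ht : t ∈ Ioc 0 T) (hv : ∀ s ∈ Ioc 0 t, s ^ (1 - ν) * ‖v s‖ ≤ M)
    (hg : ∀ s ∈ Ioc 0 t, s ^ (1 - ν) * ‖g s‖ ≤ M) :
    interpNorm i ν (i (v t) - x) ≤ (1 / ν + 2) * M := by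
  have hM : 0 ≤ M := le_trans (mul_nonneg (Real.rpow_nonneg ht.1.le _) (norm_nonneg _))
    (hv t ⟨ht.1, le_rfl⟩)
  refine interpNorm_le fun s hs => ?_
  -- For s ≥ t the whole vector is estimated in E₀. For s ≤ t it is split as (i v(s) − x) + i (v(t)
  -- − v(s)), the curve itself supplying the decomposition at scale s.
  rcases le_total t s with hts | hst
  · calc kFun i s (i (v t) - x) ≤ ‖i (v t) - x‖ := kFun_le_norm i hs.le _
      _ ≤ M * t ^ ν / ν := H.norm_sub_le hν ht hg
      _ ≤ M * s ^ ν / ν := by have := ht.1; gcongr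
      _ ≤ M * s ^ ν / ν + 2 * (M * s ^ ν) := le_add_of_nonneg_right (by positivity)
      _ = _ := by ring
  · have hsT : s ∈ Ioc 0 T := ⟨hs, hst.trans ht.2⟩
    have a := H.norm_sub_le hν hsT (M := M) fun r hr => hg r ⟨hr.1, hr.2.trans hst⟩
    have b := norm_le_rpow_of_weight_le hs (hv s ⟨hs, hst⟩)
    have b' := norm_le_rpow_of_weight_le ht.1 (hv t ⟨ht.1, le_rfl⟩)
    have b'' : M * t ^ (ν - 1) ≤ M * s ^ (ν - 1) :=
      mul_le_mul_of_nonneg_left (Real.rpow_le_rpow_of_nonpos hs hst (by linarith)) hM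
    have c : s * s ^ (ν - 1) = s ^ ν := by
      rw [Real.rpow_sub_one hs.ne']; field_simp
    have e := kFun_le i hs.le (i (v t) - x) (v t - v s)
    have e1 : i (v t) - x - i (v t - v s) = i (v s) - x := by rw [map_sub]; abel
    rw [e1] at e
    calc _ ≤ _ := e
      _ ≤ M * s ^ ν / ν + s * (M * s ^ (ν - 1) + M * s ^ (ν - 1)) := by
          gcongr
          exact (_root_.norm_sub_le _ _).trans (add_le_add (b'.trans b'') b)
      _ = M * s ^ ν / ν + 2 * M * (s * s ^ (ν - 1)) := by ring
      _ = _ := by rw [c]; ring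

/-- Continuity at `0` in `E_ν`. -/
theorem IsPrimitive.exists_interpNorm_sub_le (hν : 0 < ν) (hν1 : ν < 1) (hT : 0 < T)
    (H : IsPrimitive i ν T x v g) {ε : ℝ} (hε : 0 < ε) :
    ∃ δ > 0, ∀ t, 0 < t → t ≤ δ → interpNorm i ν (i (v t) - x) ≤ ε := by
  set η := ε / (1 / ν + 2) with hη
  have hη0 : 0 < η := by positivity
  obtain ⟨δ, hδ, H1⟩ := H.1.exists_le hη0
  obtain ⟨δ', hδ', H2⟩ := H.2.exists_le hη0
  refine ⟨min T (min δ δ'), lt_min hT (lt_min hδ hδ'), fun t ht h => ?_⟩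
  have hδt := (h.trans (min_le_right _ _)).trans (min_le_left _ _)
  have hδt' := (h.trans (min_le_right _ _)).trans (min_le_right _ _)
  have := H.interpNorm_sub_le hν hν1 ⟨ht, h.trans (min_le_left _ _)⟩
    (fun s hs => H1 s hs.1 (hs.2.trans hδt)) (fun s hs => H2 s hs.1 (hs.2.trans hδt'))
  refine this.trans (le_of_eq ?_)
  rw [hη]; field_simp

end Trace

/-! ### Extending elements of E_ν to curves in 𝔼_{1,ν} -/

section Extension

open MeasureTheory

theorem intervalIntegrable_of_continuousOn_Ioi {E : Type*} [NormedAddCommGroup E] {f : ℝ → E}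
    (hf : ContinuousOn f (Ioi 0)) {r s : ℝ} (hr : 0 < r) (hs : 0 < s) :
    IntervalIntegrable f volume r s :=
  (hf.mono fun _ hu => (lt_min hr hs).trans_le hu.1).intervalIntegrable

/-- Averaging over [r, 2r] smooths a merely continuous curve, with a derivative expressed through
the values of f alone. -/
theorem hasDerivAt_average {E : Type*} [NormedAddCommGroup E] [NormedSpace ℝ E] [CompleteSpace E]
    {f : ℝ → E} (hf : ContinuousOn f (Ioi 0)) {t : ℝ} (ht : 0 < t) :
    HasDerivAt (fun r : ℝ => r⁻¹ • ∫ s in r..2 * r, f s)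
      (t⁻¹ • ((2 : ℝ) • f (2 * t) - f t) - (t ^ 2)⁻¹ • ∫ s in t..2 * t, f s) t := by
  have hΦ : ∀ r : ℝ, 0 < r → HasDerivAt (fun r => ∫ s in (1 : ℝ)..r, f s) (f r) r := fun r hr =>
    intervalIntegral.integral_hasDerivAt_right (intervalIntegrable_of_continuousOn_Ioi hf one_pos hr)
      (hf.stronglyMeasurableAtFilter isOpen_Ioi r hr) (hf.continuousAt (Ioi_mem_nhds hr))
  have h2 : HasDerivAt (fun r : ℝ => ∫ s in (1 : ℝ)..2 * r, f s) ((2 : ℝ) • f (2 * t)) t := by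
    have h3 : HasDerivAt (fun r : ℝ => 2 * r) 2 t := by
      simpa using (hasDerivAt_id t).const_mul 2
    exact (hΦ (2 * t) (by positivity)).scomp t h3
  have h4 := (hasDerivAt_inv ht.ne').smul (h2.sub (hΦ t ht))
  have e : ∀ r : ℝ, 0 < r → ∫ s in r..2 * r, f s =
      (∫ s in (1 : ℝ)..2 * r, f s) - ∫ s in (1 : ℝ)..r, f s := fun r hr =>
    (intervalIntegral.integral_interval_sub_left (intervalIntegrable_of_continuousOn_Ioi hf one_pos
      (by positivity)) (intervalIntegrable_of_continuousOn_Ioi hf one_pos hr)).symm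
  refine (h4.congr_of_eventuallyEq ?_).congr_deriv ?_
  · filter_upwards [Ioi_mem_nhds ht] with r hr
    rw [e r hr]; rfl
  · simp only [Pi.sub_apply]
    rw [e t ht, neg_smul, ← sub_eq_add_neg]

variable {E₀ E₁ : Type*} [NormedAddCommGroup E₀] [NormedSpace ℝ E₀]
  [NormedAddCommGroup E₁] [NormedSpace ℝ E₁] (i : E₁ →L[ℝ] E₀)

/-- For each b, the factor t/s ≥ 1 lifts ‖x − i b‖ + s‖b‖ above ‖x − i b‖ + t‖b‖. Together with
monotonicity this makes K at neighbouring scales comparable. -/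
theorem kFun_le_div_mul {s t : ℝ} (hs : 0 < s) (hst : s ≤ t) (x : E₀) :
    kFun i t x ≤ t / s * kFun i s x := by
  have ht := hs.trans_le hst
  rw [div_mul_eq_mul_div, le_div_iff₀ hs, mul_comm, ← div_le_iff₀' ht]
  refine le_kFun i fun b => ?_
  rw [div_le_iff₀' ht]
  calc s * kFun i t x ≤ s * (‖x - i b‖ + t * ‖b‖) := by gcongr; exact kFun_le i ht.le x b
    _ ≤ t * ‖x - i b‖ + t * (s * ‖b‖) := by
        rw [mul_add]
        have := mul_le_mul_of_nonneg_right hst (norm_nonneg (x - i b))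
        nlinarith
    _ = _ := by ring

theorem kFun_pos {t : ℝ} (ht : 0 < t) {x : E₀} (hx : x ≠ 0) : 0 < kFun i t x := by
  have h1 : 0 < kFun i 1 x := by
    by_contra h
    have := norm_le_kFun_one i x
    have : ‖x‖ ≤ 0 := this.trans (mul_nonpos_of_nonneg_of_nonpos (by positivity) (not_lt.1 h))
    exact hx (norm_le_zero_iff.1 this)
  rcases le_total t 1 with h | h
  · have := kFun_le_div_mul i ht h x
    by_contra h'
    have : kFun i 1 x ≤ 0 :=
      this.trans (mul_nonpos_of_nonneg_of_nonpos (by positivity) (not_lt.1 h'))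
    linarith
  · exact h1.trans_le (kFun_mono i zero_le_one h x)

/-- A continuous choice of almost optimal decompositions in the `K`-functional. -/
theorem exists_continuousOn_lt_kFun {x : E₀} (hx : x ≠ 0) :
    ∃ b : ℝ → E₁, ContinuousOn b (Ioi 0) ∧ ∀ t > 0, ‖x - i (b t)‖ + t * ‖b t‖ < 3 * kFun i t x := by
  -- The admissible b form a convex set at each scale, so locally constant choices are glued by a
  -- partition of unity on (0, ∞).
  obtain ⟨g, hg⟩ := exists_continuous_forall_mem_convex_of_local_const
    (X := Ioi (0 : ℝ)) (t := fun t => {b : E₁ | ‖x - i b‖ + (t : ℝ) * ‖b‖ < 3 * kFun i t x})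
    (fun t => by
      have h1 : ConvexOn ℝ univ (fun b : E₁ => ‖x - i b‖) := by
        have : ConvexOn ℝ univ (fun y : E₀ => ‖x - y‖) := by
          simpa [dist_eq_norm, norm_sub_rev] using convexOn_univ_dist (E := E₀) x
        exact this.comp_linearMap i.toLinearMap
      have h2 : ConvexOn ℝ univ (fun b : E₁ => (t : ℝ) * ‖b‖) := by
        simpa using (convexOn_univ_norm (E := E₁)).smul (le_of_lt t.2)
      simpa using (h1.add h2).convex_lt (3 * kFun i t x))
    (fun t => by
      have ht : (0 : ℝ) < t := t.2
      have hK := kFun_pos i ht hx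
      -- A choice with factor 2 at scale t keeps factor 3 at nearby s > 2t/3, since there K(t, x) ≤
      -- (3/2) K(s, x). Positivity of K, hence x ≠ 0, provides c.
      obtain ⟨c, hc⟩ := exists_lt_of_kFun_lt i (show kFun i t x < 2 * kFun i t x by linarith)
      refine ⟨c, ?_⟩
      have h1 : ∀ᶠ s : Ioi (0 : ℝ) in 𝓝 t, ‖x - i c‖ + (s : ℝ) * ‖c‖ < 2 * kFun i t x := by
        have hcont : Continuous fun s : Ioi (0 : ℝ) => ‖x - i c‖ + (s : ℝ) * ‖c‖ := by fun_prop
        exact hcont.continuousAt.eventually (gt_mem_nhds hc)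
      have h2 : ∀ᶠ s : Ioi (0 : ℝ) in 𝓝 t, 2 / 3 * (t : ℝ) < s :=
        continuous_subtype_val.continuousAt.eventually (lt_mem_nhds (by linarith))
      filter_upwards [h1, h2] with s hs1 hs2
      refine hs1.trans_le ?_
      have hs : (0 : ℝ) < s := s.2
      rcases le_total (s : ℝ) t with h | h
      · have a := kFun_le_div_mul i hs h x
        have b : (t : ℝ) / s ≤ 3 / 2 := by rw [div_le_iff₀ hs]; linarith
        have := mul_le_mul_of_nonneg_right b (kFun_nonneg i hs.le x)
        linarith
      · have := kFun_mono i ht.le h x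
        linarith)
  refine ⟨fun t => if h : 0 < t then g ⟨t, h⟩ else 0, ?_, fun t ht => ?_⟩
  · rw [continuousOn_iff_continuous_domRestrict]
    refine g.continuous.congr fun t => ?_
    have : (0 : ℝ) < t := t.2
    simp [this]
  · have ht' : 0 < t := ht
    simpa [ht'] using hg ⟨t, ht⟩

/-- The constant is 24 = 12 · 2, because (2t)^ν ≤ 2 t^ν. -/
theorem weight_le_of_mul_norm_le_kFun {E : Type*} [NormedAddCommGroup E] {ν : ℝ}
    (hν1 : ν < 1) {x : E₀} {a : E} {t N : ℝ} (ht : 0 < t)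
    (h1 : t * ‖a‖ ≤ 12 * kFun i (2 * t) x) (h2 : kFun i (2 * t) x ≤ (2 * t) ^ ν * N) (hN : 0 ≤ N) :
    t ^ (1 - ν) * ‖a‖ ≤ 24 * N := by
  have h3 : (2 * t) ^ ν ≤ 2 * t ^ ν := by
    rw [Real.mul_rpow zero_le_two ht.le]
    gcongr
    simpa using Real.rpow_le_rpow_of_exponent_le (one_le_two (α := ℝ)) hν1.le
  have h4 : t ^ (1 - ν) * ‖a‖ = t ^ (-ν) * (t * ‖a‖) := by
    rw [sub_eq_neg_add, Real.rpow_add ht, Real.rpow_one, mul_assoc]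
  rw [h4, Real.rpow_neg ht.le, inv_mul_le_iff₀ (Real.rpow_pos_of_pos ht ν)]
  have := mul_le_mul_of_nonneg_right h3 hN
  linarith

variable {i} in
theorem memBC_of_mul_norm_le_kFun {E : Type*} [NormedAddCommGroup E] {ν T : ℝ}
    (hν1 : ν < 1) {x : E₀} (hx : x ∈ interpSpace i ν) {f : ℝ → E} (hf : ContinuousOn f (Ioi 0))
    (hfK : ∀ t > 0, t * ‖f t‖ ≤ 12 * kFun i (2 * t) x) : MemBC ν T f := by
  refine memBC_of_forall_le (hf.mono Ioc_subset_Ioi_self) fun ε hε => ?_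
  obtain ⟨δ, hδ, H⟩ := mem_interpSpace_iff.1 hx (ε / 24) (by positivity)
  refine ⟨δ / 2, half_pos hδ, fun t ht htδ => ?_⟩
  have := weight_le_of_mul_norm_le_kFun i hν1 ht (hfK t ht)
    (H (2 * t) (by positivity) (by linarith)) (by positivity)
  linarith

variable {i} {ν T : ℝ} [CompleteSpace E₀] [CompleteSpace E₁]

/-- Every element of `E_ν` is the trace of an element of `𝔼_{1,ν}`, with a norm bound. -/
theorem exists_isPrimitive_of_mem_interpSpace (hν : 0 < ν) (hν1 : ν < 1) {x : E₀}
    (hx : x ∈ interpSpace i ν) (T : ℝ) :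
    ∃ (v : ℝ → E₁) (g : ℝ → E₀), IsPrimitive i ν T x v g ∧ ∀ t ∈ Ioc 0 T,
      t ^ (1 - ν) * ‖v t‖ ≤ 24 * interpNorm i ν x ∧
      t ^ (1 - ν) * ‖g t‖ ≤ 24 * interpNorm i ν x := by
  rcases eq_or_ne x 0 with rfl | hx0
  · exact ⟨fun _ => 0, fun _ => 0, ⟨memBC_zero, memBC_zero, fun t _ => by simp⟩,
      fun t _ => by simp [interpNorm_zero]⟩
  obtain ⟨b, hb, hbK⟩ := exists_continuousOn_lt_kFun i hx0
  -- Since i ∘ v − x is the average of c over [t, 2t], its derivative g involves only c, and ‖c(s)‖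
  -- ≤ 3 K(s, x).
  set c : ℝ → E₀ := fun s => i (b s) - x with hc
  have hcc : ContinuousOn c (Ioi 0) := (i.continuous.comp_continuousOn hb).sub continuousOn_const
  set v : ℝ → E₁ := fun t => t⁻¹ • ∫ s in t..2 * t, b s with hv
  set g : ℝ → E₀ := fun t =>
    t⁻¹ • ((2 : ℝ) • c (2 * t) - c t) - (t ^ 2)⁻¹ • ∫ s in t..2 * t, c s with hg
  have hc_le : ∀ s > 0, ‖c s‖ ≤ 3 * kFun i s x := fun s hs => by
    have := hbK s hs
    rw [norm_sub_rev] at this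
    have h2 : 0 ≤ s * ‖b s‖ := mul_nonneg hs.le (norm_nonneg _)
    linarith
  have hb_le : ∀ s > 0, s * ‖b s‖ ≤ 3 * kFun i s x := fun s hs => by
    have := hbK s hs
    linarith [norm_nonneg (x - i (b s))]
  have hmem : ∀ {t s : ℝ}, 0 < t → s ∈ uIoc t (2 * t) → t ≤ s ∧ s ≤ 2 * t := by
    intro t s ht hs
    rw [uIoc_of_le (by linarith)] at hs
    exact ⟨hs.1.le, hs.2⟩
  have hcI : ∀ t > 0, ‖∫ s in t..2 * t, c s‖ ≤ 3 * kFun i (2 * t) x * t := fun t ht => by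
    have := intervalIntegral.norm_integral_le_of_norm_le_const (a := t) (b := 2 * t) (f := c)
      (C := 3 * kFun i (2 * t) x) fun s hs => by
        have hs' := hmem ht hs
        have h0 := ht.trans_le hs'.1
        refine (hc_le s h0).trans ?_
        have := kFun_mono i h0.le hs'.2 x
        linarith
    rwa [show 2 * t - t = t by ring, abs_of_pos ht] at this
  have hv_le : ∀ t > 0, t * ‖v t‖ ≤ 3 * kFun i (2 * t) x := fun t ht => by
    have := intervalIntegral.norm_integral_le_of_norm_le_const (a := t) (b := 2 * t) (f := b)
      (C := 3 * kFun i (2 * t) x / t) fun s hs => by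
        have hs' := hmem ht hs
        have h0 := ht.trans_le hs'.1
        rw [le_div_iff₀ ht]
        have h1 := kFun_mono i h0.le hs'.2 x
        have h2 := hb_le s h0
        have h3 := mul_le_mul_of_nonneg_left hs'.1 (norm_nonneg (b s))
        linarith
    rw [show 2 * t - t = t by ring, abs_of_pos ht, div_mul_cancel₀ _ ht.ne'] at this
    rw [hv]
    simp only [norm_smul, norm_inv, Real.norm_eq_abs, abs_of_pos ht]
    rwa [mul_inv_cancel_left₀ ht.ne']
  -- The three terms of t g(t) contribute 6 + 3 + 3 = 12.
  have hg_le : ∀ t > 0, t * ‖g t‖ ≤ 12 * kFun i (2 * t) x := fun t ht => by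
    have h1 : t • g t = ((2 : ℝ) • c (2 * t) - c t) - t⁻¹ • ∫ s in t..2 * t, c s := by
      rw [hg]
      rw [smul_sub t, smul_smul, smul_smul]
      rw [mul_inv_cancel₀ ht.ne', one_smul, show t * (t ^ 2)⁻¹ = t⁻¹ by field_simp]
    have h2 : t * ‖g t‖ = ‖t • g t‖ := by rw [norm_smul, Real.norm_eq_abs, abs_of_pos ht]
    rw [h2, h1]
    have h3 : ‖t⁻¹ • ∫ s in t..2 * t, c s‖ ≤ 3 * kFun i (2 * t) x := by
      rw [norm_smul, norm_inv, Real.norm_eq_abs, abs_of_pos ht, inv_mul_le_iff₀ ht]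
      linarith [hcI t ht]
    have h4 : ‖(2 : ℝ) • c (2 * t)‖ ≤ 6 * kFun i (2 * t) x := by
      rw [norm_smul, Real.norm_eq_abs, abs_two]
      linarith [hc_le (2 * t) (by positivity)]
    have h5 : ‖c t‖ ≤ 3 * kFun i (2 * t) x := (hc_le t ht).trans (by
      have := kFun_mono i ht.le (show t ≤ 2 * t by linarith) x
      linarith)
    have h6 := norm_sub_le ((2 : ℝ) • c (2 * t) - c t) (t⁻¹ • ∫ s in t..2 * t, c s)
    have h7 := norm_sub_le ((2 : ℝ) • c (2 * t)) (c t)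
    linarith
  have hiv : ∀ t > 0, i (v t) = x + t⁻¹ • ∫ s in t..2 * t, c s := fun t ht => by
    have h1 : ∫ s in t..2 * t, c s = i (∫ s in t..2 * t, b s) - t • x := by
      have h2t : 0 < 2 * t := by positivity
      calc ∫ s in t..2 * t, c s = (∫ s in t..2 * t, i (b s)) - ∫ s in t..2 * t, x :=
            intervalIntegral.integral_sub (intervalIntegrable_of_continuousOn_Ioi
              (i.continuous.comp_continuousOn hb) ht h2t) intervalIntegrable_const
        _ = _ := by
            rw [i.intervalIntegral_comp_comm (intervalIntegrable_of_continuousOn_Ioi hb ht h2t),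
              intervalIntegral.integral_const, show 2 * t - t = t by ring]
    rw [h1, smul_sub, smul_smul, inv_mul_cancel₀ ht.ne', one_smul, hv]
    simp
  have hvc : ContinuousOn v (Ioi 0) := fun t ht =>
    (hasDerivAt_average hb ht).continuousAt.continuousWithinAt
  have hd : ∀ t > 0, HasDerivAt (fun s => i (v s)) (g t) t := fun t ht =>
    ((hasDerivAt_average hcc ht).const_add x).congr_of_eventuallyEq (by
      filter_upwards [Ioi_mem_nhds ht] with s hs using hiv s hs)
  have hgc : ContinuousOn g (Ioi 0) := by
    have h2 : ContinuousOn (fun t : ℝ => c (2 * t)) (Ioi 0) :=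
      hcc.comp (by fun_prop) fun t ht => by
        have : (0 : ℝ) < t := ht
        exact mem_Ioi.2 (by positivity)
    have h3 : ContinuousOn (fun t : ℝ => t⁻¹) (Ioi 0) :=
      continuousOn_inv₀.mono fun t ht => (ne_of_gt ht : t ≠ 0)
    have h4 : ContinuousOn (fun t : ℝ => t⁻¹ • ∫ s in t..2 * t, c s) (Ioi 0) := fun t ht =>
      (hasDerivAt_average hcc ht).continuousAt.continuousWithinAt
    refine ((h3.smul ((h2.const_smul (2 : ℝ)).sub hcc)).sub (h3.smul h4)).congr fun t ht => ?_
    simp only [hg, Pi.smul_apply', Pi.sub_apply, Pi.smul_apply, smul_smul]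
    rw [pow_two, mul_inv]
  have hv_le' : ∀ t > 0, t * ‖v t‖ ≤ 12 * kFun i (2 * t) x := fun t ht =>
    (hv_le t ht).trans (by linarith [kFun_nonneg i (show 0 ≤ 2 * t by positivity) x])
  refine ⟨v, g, isPrimitive_of_hasDerivWithinAt hν (memBC_of_mul_norm_le_kFun hν1 hx hvc hv_le') (memBC_of_mul_norm_le_kFun hν1 hx hgc hg_le)
    (fun s hs => (hd s hs.1).hasDerivWithinAt) ?_, fun t ht => ?_⟩
  · refine tendsto_iff_norm_sub_tendsto_zero.2 (tendsto_nhdsGT_zero_of_forall_le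
      (fun t _ => norm_nonneg _) fun ε hε => ?_)
    obtain ⟨δ, hδ, H⟩ := mem_interpSpace_iff.1 hx (ε / 3) (by positivity)
    refine ⟨min (δ / 2) (1 / 2), lt_min (half_pos hδ) (by norm_num), fun t ht h => ?_⟩
    have h1 := H (2 * t) (by positivity) (by linarith [h.trans (min_le_left _ _)])
    have h2 : (2 * t) ^ ν ≤ 1 :=
      Real.rpow_le_one (by positivity) (by linarith [h.trans (min_le_right _ _)]) hν.le
    rw [hiv t ht, add_sub_cancel_left, norm_smul, norm_inv, Real.norm_eq_abs, abs_of_pos ht,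
      inv_mul_le_iff₀ ht]
    refine (hcI t ht).trans ?_
    have h3 : (2 * t) ^ ν * (ε / 3) ≤ 1 * (ε / 3) := by gcongr
    nlinarith
  · have hK := kFun_le_interpNorm hν.le hx (show 0 < 2 * t by linarith [ht.1])
    exact ⟨weight_le_of_mul_norm_le_kFun i hν1 ht.1 (hv_le' t ht.1) hK (interpNorm_nonneg _ _ _),
      weight_le_of_mul_norm_le_kFun i hν1 ht.1 (hg_le t ht.1) hK (interpNorm_nonneg _ _ _)⟩

end Extension

/-! ### BC_{1-μ} as a Banach space -/

section WeightedSpace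

variable {E : Type*} [NormedAddCommGroup E] [NormedSpace ℝ E] {μ T : ℝ}

/-- Continuous functions on `[0,T]` vanishing at `0`. -/
def vanishingAtZero (T : ℝ) (E : Type*) [NormedAddCommGroup E] [NormedSpace ℝ E] :
    Submodule ℝ C(Icc (0 : ℝ) T, E) where
  carrier := {g | ∀ t : Icc (0 : ℝ) T, (t : ℝ) = 0 → g t = 0}
  zero_mem' := fun _ _ => rfl
  add_mem' := fun {a b} ha hb t ht => by simp [ha t ht, hb t ht]
  smul_mem' := fun c a ha t ht => by simp [ha t ht]

theorem isClosed_vanishingAtZero :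
    IsClosed (vanishingAtZero T E : Set C(Icc (0 : ℝ) T, E)) := by
  have : (vanishingAtZero T E : Set C(Icc (0 : ℝ) T, E)) =
      ⋂ (t : Icc (0 : ℝ) T) (_ : (t : ℝ) = 0), {g | g t = 0} := by
    ext g; simp [vanishingAtZero]
  rw [this]
  exact isClosed_iInter fun t => isClosed_iInter fun _ =>
    isClosed_eq (continuous_eval_const (F := C(Icc (0 : ℝ) T, E)) t) continuous_const

instance [CompleteSpace E] : CompleteSpace (vanishingAtZero T E) :=
  isClosed_vanishingAtZero.completeSpace_coe

open Classical in
/-- The isomorphism `g ↦ t^{μ-1} g` onto `BC_{1-μ}([0,T], E)`. -/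
noncomputable def unweight (μ : ℝ) (g : vanishingAtZero T E) (t : ℝ) : E :=
  if h : t ∈ Icc 0 T then t ^ (μ - 1) • (g : C(Icc (0 : ℝ) T, E)) ⟨t, h⟩ else 0

theorem unweight_add (f g : vanishingAtZero T E) (t : ℝ) :
    unweight μ (f + g) t = unweight μ f t + unweight μ g t := by
  unfold unweight; split_ifs <;> simp

theorem unweight_sub (f g : vanishingAtZero T E) (t : ℝ) :
    unweight μ (f - g) t = unweight μ f t - unweight μ g t := by
  unfold unweight; split_ifs <;> simp [smul_sub]

theorem unweight_smul (c : ℝ) (g : vanishingAtZero T E) (t : ℝ) :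
    unweight μ (c • g) t = c • unweight μ g t := by
  unfold unweight; split_ifs <;> simp [smul_comm c]

theorem rpow_smul_unweight (g : vanishingAtZero T E) {t : ℝ} (ht : t ∈ Ioc 0 T) :
    t ^ (1 - μ) • unweight μ g t =
      (g : C(Icc (0 : ℝ) T, E)) ⟨t, Ioc_subset_Icc_self ht⟩ := by
  rw [unweight, dif_pos (Ioc_subset_Icc_self ht), smul_smul, ← Real.rpow_add ht.1]
  simp

theorem rpow_mul_norm_unweight (g : vanishingAtZero T E) {t : ℝ} (ht : t ∈ Ioc 0 T) :
    t ^ (1 - μ) * ‖unweight μ g t‖ =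
      ‖(g : C(Icc (0 : ℝ) T, E)) ⟨t, Ioc_subset_Icc_self ht⟩‖ := by
  rw [← rpow_smul_unweight (μ := μ) g ht, norm_smul, Real.norm_of_nonneg
    (Real.rpow_nonneg ht.1.le _)]

theorem rpow_mul_norm_unweight_le (g : vanishingAtZero T E) {t : ℝ} (ht : t ∈ Ioc 0 T) :
    t ^ (1 - μ) * ‖unweight μ g t‖ ≤ ‖g‖ := by
  rw [rpow_mul_norm_unweight g ht]
  exact ContinuousMap.norm_coe_le_norm (g : C(Icc (0 : ℝ) T, E)) _

/-- The weighted bound omits t = 0, which costs nothing because g vanishes there; with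
`rpow_mul_norm_unweight_le` this makes `unweight` isometric. -/
theorem norm_le_of_unweight (g : vanishingAtZero T E) {M : ℝ} (hM : 0 ≤ M)
    (h : ∀ t ∈ Ioc 0 T, t ^ (1 - μ) * ‖unweight μ g t‖ ≤ M) : ‖g‖ ≤ M := by
  refine (ContinuousMap.norm_le (g : C(Icc (0 : ℝ) T, E)) hM).2 fun t => ?_
  rcases eq_or_lt_of_le t.2.1 with h0 | h0
  · rw [g.2 t h0.symm, norm_zero]; exact hM
  · have := h t ⟨h0, t.2.2⟩
    rwa [rpow_mul_norm_unweight g ⟨h0, t.2.2⟩] at this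

theorem eq_of_unweight_eqOn {f g : vanishingAtZero T E}
    (h : EqOn (unweight μ f) (unweight μ g) (Ioc 0 T)) : f = g := by
  rw [← sub_eq_zero, ← norm_le_zero_iff]
  refine norm_le_of_unweight (μ := μ) _ le_rfl fun t ht => ?_
  rw [unweight_sub, h ht]
  simp

theorem unweight_memBC (g : vanishingAtZero T E) : MemBC μ T (unweight μ g) := by
  have hc : ContinuousOn (unweight μ g) (Ioc 0 T) := by
    rw [continuousOn_iff_continuous_domRestrict]
    have : Continuous fun t : Ioc (0 : ℝ) T =>
        (t : ℝ) ^ (μ - 1) • (g : C(Icc (0 : ℝ) T, E)) ⟨t, Ioc_subset_Icc_self t.2⟩ := by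
      refine Continuous.smul ?_ (by fun_prop)
      exact continuous_subtype_val.rpow_const fun t => Or.inl t.2.1.ne'
    refine this.congr fun t => ?_
    simp only [unweight, domRestrict_apply]
    rw [dif_pos (Ioc_subset_Icc_self t.2)]
  rcases le_or_gt T 0 with hT | hT
  · refine ⟨hc, ⟨0, fun t ht => absurd (ht.1.trans_le ht.2) (not_lt.2 hT)⟩, ?_⟩
    have h0 : ∀ t > 0, unweight μ g t = 0 := fun t ht =>
      dif_neg fun h => absurd (lt_of_lt_of_le ht h.2) (not_lt.2 hT)
    refine tendsto_const_nhds.congr' ?_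
    filter_upwards [self_mem_nhdsWithin] with t ht
    rw [h0 t ht]; simp
  · refine memBC_of_tendsto hc ?_
    have h1 : Tendsto (fun t : Icc (0 : ℝ) T => ‖(g : C(Icc (0 : ℝ) T, E)) t‖)
        (𝓝 ⟨0, le_rfl, hT.le⟩) (𝓝 0) := by
      have := ((g : C(Icc (0 : ℝ) T, E)).continuous.norm).tendsto ⟨0, le_rfl, hT.le⟩
      rwa [g.2 ⟨0, le_rfl, hT.le⟩ rfl, norm_zero] at this
    refine tendsto_nhdsGT_zero_of_forall_le (fun t ht =>
      mul_nonneg (Real.rpow_nonneg (le_of_lt ht) _) (norm_nonneg _)) fun ε hε => ?_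
    obtain ⟨δ, hδ, H⟩ := Metric.eventually_nhds_iff.1 (h1.eventually (gt_mem_nhds hε))
    refine ⟨min T (δ / 2), lt_min hT (half_pos hδ), fun t ht h => ?_⟩
    have htT : t ∈ Ioc 0 T := ⟨ht, h.trans (min_le_left _ _)⟩
    rw [rpow_mul_norm_unweight g htT]
    refine (H ?_).le
    rw [Subtype.dist_eq, Real.dist_eq, sub_zero, abs_of_pos ht]
    linarith [h.trans (min_le_right _ _)]

/-- By the decay condition t^(1−μ) f(t) extends continuously by 0 to t = 0. The formula itself takes
that value, as 0^(1−μ) = 0 for μ < 1. -/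
theorem MemBC.exists_unweight_eqOn {f : ℝ → E} (hμ : μ < 1) (hf : MemBC μ T f) :
    ∃ g : vanishingAtZero T E, EqOn (unweight μ g) f (Ioc 0 T) := by
  have hc : ContinuousOn (fun t : ℝ => t ^ (1 - μ) • f t) (Icc 0 T) := by
    intro t ht
    rcases eq_or_lt_of_le ht.1 with rfl | h0
    · have h1 : ContinuousWithinAt (fun t : ℝ => t ^ (1 - μ) • f t) (Ioi 0) 0 := by
        refine tendsto_zero_iff_norm_tendsto_zero.2 ?_ |>.trans_eq ?_
        · refine hf.3.congr' ?_
          filter_upwards [self_mem_nhdsWithin] with t ht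
          rw [norm_smul, Real.norm_of_nonneg (Real.rpow_nonneg (le_of_lt ht) _)]
        · simp [Real.zero_rpow (sub_pos.2 hμ).ne']
      refine (continuousWithinAt_insert_self.2 h1).mono fun s hs => ?_
      exact (eq_or_lt_of_le hs.1).imp Eq.symm id
    · have h2 : ContinuousWithinAt f (Ioc 0 T) t := hf.1 t ⟨h0, ht.2⟩
      have h3 : ContinuousWithinAt f (Icc 0 T) t := by
        refine h2.mono_of_mem_nhdsWithin ?_
        filter_upwards [self_mem_nhdsWithin, mem_nhdsWithin_of_mem_nhds (Ioi_mem_nhds h0)]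
          with s hs hs' using ⟨hs', hs.2⟩
      exact ((Real.continuousAt_rpow_const _ _ (Or.inl h0.ne')).continuousWithinAt).smul h3
  have hc' : Continuous fun t : Icc (0 : ℝ) T => (t : ℝ) ^ (1 - μ) • f t :=
    continuousOn_iff_continuous_domRestrict.1 hc
  have h0 : (⟨_, hc'⟩ : C(Icc (0 : ℝ) T, E)) ∈ vanishingAtZero T E := fun t ht => by
    simp [ht, Real.zero_rpow (sub_pos.2 hμ).ne']
  refine ⟨⟨_, h0⟩, fun t ht => ?_⟩
  rw [unweight, dif_pos (Ioc_subset_Icc_self ht), ContinuousMap.coe_mk, smul_smul,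
    ← Real.rpow_add ht.1]
  simp

/-- Extension of `f ∈ BC_{1-μ}([0,δ], E)` to all of `(0,∞)` without increasing the norm. -/
theorem MemBC.exists_extend {f : ℝ → E} {δ : ℝ} (hδ : 0 < δ) (hf : MemBC μ δ f) :
    ∃ g : ℝ → E, EqOn g f (Ioc 0 δ) ∧ ∀ T, MemBC μ T g ∧
      ∀ M, (∀ t ∈ Ioc 0 δ, t ^ (1 - μ) * ‖f t‖ ≤ M) → ∀ t > 0, t ^ (1 - μ) * ‖g t‖ ≤ M := by
  -- Past δ the weighted function is frozen at its value at δ, so weighted bounds persist.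
  have e : ∀ t > 0, t ^ (1 - μ) * ‖t ^ (μ - 1) • (min t δ) ^ (1 - μ) • f (min t δ)‖ =
      (min t δ) ^ (1 - μ) * ‖f (min t δ)‖ := fun t ht => by
    have hm : 0 < min t δ := lt_min ht hδ
    rw [norm_smul, norm_smul, Real.norm_of_nonneg (Real.rpow_nonneg (le_of_lt ht) _),
      Real.norm_of_nonneg (Real.rpow_nonneg hm.le _), ← mul_assoc, ← Real.rpow_add ht]
    simp
  have heq : EqOn (fun t => t ^ (μ - 1) • (min t δ) ^ (1 - μ) • f (min t δ)) f (Ioc 0 δ) := by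
    intro t ht
    simp only [min_eq_left ht.2]
    rw [smul_smul, ← Real.rpow_add ht.1]
    simp
  refine ⟨fun t => t ^ (μ - 1) • (min t δ) ^ (1 - μ) • f (min t δ), heq, fun T =>
    ⟨memBC_of_forall_le ?_ fun ε hε => ?_, fun M hM t ht => ?_⟩⟩
  · have hm : ContinuousOn (fun t : ℝ => min t δ) (Ioc 0 T) := by fun_prop
    have hmaps : MapsTo (fun t : ℝ => min t δ) (Ioc 0 T) (Ioc 0 δ) := fun t ht =>
      ⟨lt_min ht.1 hδ, min_le_right _ _⟩
    refine (continuousOn_id.rpow_const fun t ht => Or.inl ht.1.ne').smul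
      ((hm.rpow_const fun t ht => Or.inl (hmaps ht).1.ne').smul (hf.1.comp hm hmaps))
  · obtain ⟨r, hr, H⟩ := hf.exists_le hε
    refine ⟨r, hr, fun t ht h => ?_⟩
    rw [e t ht]
    exact H _ (lt_min ht hδ) ((min_le_left _ _).trans h)
  · simp only []
    rw [e t ht]
    exact hM _ ⟨lt_min ht hδ, min_le_right _ _⟩

end WeightedSpace

/-! ### Linear estimates at weights ν ≥ μ -/

section Linear

open MeasureTheory

variable {E₀ E₁ : Type*} [NormedAddCommGroup E₀] [NormedSpace ℝ E₀]
  [NormedAddCommGroup E₁] [NormedSpace ℝ E₁]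
  {i : E₁ →L[ℝ] E₀} {μ ν T : ℝ} {B : E₁ →L[ℝ] E₀}

/-- The a priori estimate at level `ν ≥ μ` for vanishing initial value. -/
theorem weight_le_of_isPrimitive_zero (hμ : 0 < μ) (hμν : μ ≤ ν) {C : ℝ}
    (huniq : ∀ δ > 0, δ ≤ T → ∀ w : ℝ → E₁, IsPrimitive i μ δ 0 w (fun t => -B (w t)) →
      EqOn w 0 (Ioc 0 δ))
    (hbound : ∀ f : ℝ → E₀, MemBC μ T f → ∃ v, IsPrimitive i μ T 0 v (fun t => f t - B (v t)) ∧
        ∀ M, (∀ t ∈ Ioc 0 T, t ^ (1 - μ) * ‖f t‖ ≤ M) →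
          ∀ t ∈ Ioc 0 T, t ^ (1 - μ) * ‖v t‖ ≤ C * M)
    {f : ℝ → E₀} {v : ℝ → E₁} {t M : ℝ} (ht : 0 < t) (htT : t ≤ T) (hf : MemBC μ t f)
    (hv : IsPrimitive i μ t 0 v (fun t => f t - B (v t)))
    (hM : ∀ s ∈ Ioc 0 t, s ^ (1 - ν) * ‖f s‖ ≤ M) : t ^ (1 - ν) * ‖v t‖ ≤ C * M := by
  -- Only f on (0, t] matters: extend it, solve on (0, T], and compare on (0, t] by uniqueness.
  -- There the μ-norm of f is at most t^(ν−μ) M; the same power splits off from t^(1−μ), so the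
  -- constant C survives unchanged.
  obtain ⟨g, hgf, hg⟩ := hf.exists_extend ht
  obtain ⟨w, hw, hwM⟩ := hbound g (hg T).1
  have h1 := hv.sub hμ (hw.mono_right htT)
  rw [sub_zero] at h1
  have h2 : v t = w t := by
    have := huniq t ht htT _ (h1.congr ht (fun _ _ => rfl) fun s hs => by
      beta_reduce; rw [hgf hs, map_sub]; abel)
    exact sub_eq_zero.1 (this ⟨ht, le_rfl⟩)
  have hM' : ∀ s ∈ Ioc 0 t, s ^ (1 - μ) * ‖f s‖ ≤ t ^ (ν - μ) * M := fun s hs =>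
    (rpow_weight_le hs.1 hs.2 hμν (f s)).trans
      (mul_le_mul_of_nonneg_left (hM s hs) (Real.rpow_nonneg ht.le _))
  have h3 := hwM _ (fun s hs => (hg T).2 _ hM' s hs.1) t ⟨ht, htT⟩
  have h4 : t ^ (1 - μ) = t ^ (ν - μ) * t ^ (1 - ν) := by
    rw [← Real.rpow_add ht]; congr 1; ring
  rw [h2]
  refine le_of_mul_le_mul_left ?_ (Real.rpow_pos_of_pos ht (ν - μ))
  calc _ = t ^ (1 - μ) * ‖w t‖ := by rw [h4]; ring
    _ ≤ _ := h3
    _ = _ := by ring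

variable [CompleteSpace E₀]

/-- The integrated form passes to limits and to delayed functions without differentiation, as needed
in the next two lemmas. -/
theorem isLinearSolution_iff (hμ : 0 < μ) (hT : 0 < T) {f : ℝ → E₀} {x : E₀} {v : ℝ → E₁} :
    IsLinearSolution i μ T B f x v ↔ IsPrimitive i μ T x v (fun t => f t - B (v t)) := by
  constructor
  · rintro ⟨h1, h2, h3⟩
    exact (h1.isPrimitive hμ h2).congr hT (fun _ _ => rfl) fun t ht => by
      rw [← h3 t ht, add_sub_cancel_right]
  · intro h
    exact ⟨h.memE1 hμ hT, h.hasTrace hμ hT, fun t ht => by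
      rw [h.timeDeriv_eq hμ ht, sub_add_cancel]⟩

variable [CompleteSpace E₁]

/-- Uniqueness for the homogeneous linear problem passes to shorter intervals. -/
theorem eqOn_zero_of_le (hi : Function.Injective i) (hμ : 0 < μ) (hμ1 : μ < 1)
    (huniq : ∀ w : ℝ → E₁, IsPrimitive i μ T 0 w (fun t => -B (w t)) → EqOn w 0 (Ioc 0 T))
    {δ : ℝ} (hδ : 0 < δ) (hδT : δ ≤ T) {w : ℝ → E₁}
    (hw : IsPrimitive i μ δ 0 w (fun t => -B (w t))) : EqOn w 0 (Ioc 0 δ) := by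
  -- Delaying w by T − δ could place its E₁-singularity inside (0, T]. The primitive W is continuous
  -- in E₁, starts at 0 and solves the same homogeneous problem, so it can be delayed and preceded
  -- by zero. Once W = 0, the identity i w = −B W gives w = 0.
  set W : ℝ → E₁ := fun t => ∫ r in (0 : ℝ)..t, w r with hW
  have hint : ∀ t, 0 ≤ t → t ≤ δ → IntervalIntegrable w volume 0 t := fun t h1 h2 =>
    hw.1.intervalIntegrable hμ le_rfl hδ.le h1 h2
  have hWc : ContinuousOn W (Icc 0 δ) := by
    have := intervalIntegral.continuousOn_primitive_interval' (hint δ hδ.le le_rfl) left_mem_uIcc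
    rwa [uIcc_of_le hδ.le] at this
  have hW0 : W 0 = 0 := intervalIntegral.integral_same
  have hiw : ∀ t ∈ Ioc 0 δ, i (w t) = -B (W t) := fun t ht => by
    rw [hw.3 t ht, zero_add, intervalIntegral.integral_neg,
      B.intervalIntegral_comp_comm (hint t ht.1.le ht.2)]
  have hiW : ∀ t, 0 ≤ t → t ≤ δ → i (W t) = ∫ r in (0 : ℝ)..t, -B (W r) := fun t h1 h2 => by
    rw [hW, ← i.intervalIntegral_comp_comm (hint t h1 h2)]
    refine intervalIntegral.integral_congr_ae (Eventually.of_forall fun r hr => ?_)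
    rw [uIoc_of_le h1] at hr
    exact hiw r ⟨hr.1, hr.2.trans h2⟩
  set s := T - δ with hs
  have hs0 : 0 ≤ s := sub_nonneg.2 hδT
  set Z : ℝ → E₁ := fun t => W (max (t - s) 0) with hZ
  have hZc : ContinuousOn Z (Icc 0 T) :=
    hWc.comp (by fun_prop) fun t ht => ⟨le_max_right _ _, max_le (by linarith [ht.2]) hδ.le⟩
  have hT : 0 < T := hδ.trans_le hδT
  have hZ0 : ∀ t, t ≤ s → Z t = 0 := fun t ht => by
    rw [hZ]; beta_reduce; rw [max_eq_right (by linarith), hW0]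
  have hZs : EqOn Z 0 (Ioc 0 T) := by
    refine huniq Z ⟨memBC_of_continuousOn_Icc hμ1 hT hZc,
      ((memBC_of_continuousOn_Icc hμ1 hT hZc).clm B).neg, fun t ht => ?_⟩
    rw [zero_add]
    have hz : ∀ r, 0 ≤ r → r ≤ s → ∫ u in (0 : ℝ)..r, -B (Z u) = 0 := fun r h1 h2 => by
      have : ∫ u in (0 : ℝ)..r, -B (Z u) = ∫ u in (0 : ℝ)..r, (0 : E₀) := by
        refine intervalIntegral.integral_congr_ae (Eventually.of_forall fun u hu => ?_)
        rw [uIoc_of_le h1] at hu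
        rw [hZ0 u (hu.2.trans h2)]; simp
      rw [this]; simp
    rcases le_total t s with h | h
    · rw [hZ0 t h, hz t ht.1.le h, map_zero]
    · have hBZ : ContinuousOn (fun u => -B (Z u)) (Icc 0 T) :=
        (B.continuous.comp_continuousOn hZc).neg
      have hI : ∀ a b, 0 ≤ a → a ≤ b → b ≤ T → IntervalIntegrable (fun u => -B (Z u)) volume a b :=
        fun a b h1 h2 h3 => ContinuousOn.intervalIntegrable_of_Icc h2
          (hBZ.mono (Icc_subset_Icc h1 h3))
      rw [← intervalIntegral.integral_add_adjacent_intervals (hI 0 s le_rfl hs0 (h.trans ht.2))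
        (hI s t hs0 h ht.2), hz s hs0 le_rfl, zero_add]
      have h1 := intervalIntegral.integral_comp_sub_right (a := s) (b := t)
        (fun u => -B (W (max u 0))) s
      rw [sub_self] at h1
      have h2 : ∫ u in (0 : ℝ)..t - s, -B (W (max u 0)) = ∫ u in (0 : ℝ)..t - s, -B (W u) := by
        refine intervalIntegral.integral_congr_ae (Eventually.of_forall fun u hu => ?_)
        rw [uIoc_of_le (by linarith)] at hu
        rw [max_eq_left hu.1.le]
      rw [show ∫ u in s..t, -B (Z u) = _ from h1, h2, ← hiW _ (by linarith) (by linarith [ht.2])]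
      rw [hZ]; beta_reduce
      rw [max_eq_left (by linarith)]
  intro t ht
  have h1 : W t = 0 := by
    have := hZs (show t + s ∈ Ioc 0 T from ⟨by linarith [ht.1], by linarith [ht.2]⟩)
    rw [hZ] at this
    simpa [max_eq_left ht.1.le] using this
  refine hi ?_
  rw [hiw t ht, h1]
  simp

/-- The a priori estimate for the linear problem with vanishing initial value: the solution operator
is bounded by the closed graph theorem. -/
theorem exists_bound_of_mem_maxReg (hi : Function.Injective i) (hμ : 0 < μ) (hμ1 : μ < 1)
    (hB : B ∈ maxReg i μ) :
    ∃ T > 0, (∀ δ > 0, δ ≤ T → ∀ w : ℝ → E₁, IsPrimitive i μ δ 0 w (fun t => -B (w t)) →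
        EqOn w 0 (Ioc 0 δ)) ∧
      ∃ C ≥ 0, ∀ f : ℝ → E₀, MemBC μ T f → ∃ v, IsPrimitive i μ T 0 v (fun t => f t - B (v t)) ∧
        ∀ M, (∀ t ∈ Ioc 0 T, t ^ (1 - μ) * ‖f t‖ ≤ M) →
          ∀ t ∈ Ioc 0 T, t ^ (1 - μ) * ‖v t‖ ≤ C * M := by
  obtain ⟨T, hT, H⟩ := hB
  have huniq : ∀ w : ℝ → E₁, IsPrimitive i μ T 0 w (fun t => -B (w t)) → EqOn w 0 (Ioc 0 T) := by
    intro w hw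
    obtain ⟨v, _, hv⟩ := H (fun _ => 0) memBC_zero 0 zero_mem_interpSpace
    have h1 := hv w ((isLinearSolution_iff hμ hT).2 (by simpa using hw))
    have h2 := hv 0 ((isLinearSolution_iff hμ hT).2
      ⟨memBC_zero, by simpa using memBC_zero, fun t _ => by simp⟩)
    exact h1.trans h2.symm
  refine ⟨T, hT, fun δ hδ hδT w hw => eqOn_zero_of_le hi hμ hμ1 huniq hδ hδT hw, ?_⟩
  have hex : ∀ g : vanishingAtZero T E₀, ∃ k : vanishingAtZero T E₁,
      IsPrimitive i μ T 0 (unweight μ k) (fun t => unweight μ g t - B (unweight μ k t)) := by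
    intro g
    obtain ⟨v, hv, _⟩ := H _ (unweight_memBC g) 0 zero_mem_interpSpace
    rw [isLinearSolution_iff hμ hT] at hv
    obtain ⟨k, hk⟩ := hv.1.exists_unweight_eqOn hμ1
    exact ⟨k, hv.congr hT hk fun t ht => by beta_reduce; rw [hk ht]⟩
  choose K hK using hex
  have hKuniq : ∀ (g : vanishingAtZero T E₀) (k : vanishingAtZero T E₁),
      IsPrimitive i μ T 0 (unweight μ k) (fun t => unweight μ g t - B (unweight μ k t)) →
      k = K g := by
    intro g k hk
    have h := hk.sub hμ (hK g)
    rw [sub_zero] at h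
    have h2 := huniq _ (h.congr hT (fun _ _ => rfl) fun t _ => by beta_reduce; rw [map_sub]; abel)
    exact eq_of_unweight_eqOn (μ := μ) fun t ht => sub_eq_zero.1 (h2 ht)
  let KL : vanishingAtZero T E₀ →ₗ[ℝ] vanishingAtZero T E₁ :=
    { toFun := K
      map_add' := fun f g => by
        refine (hKuniq _ _ ?_).symm
        have h := (hK f).add hμ (hK g)
        rw [add_zero] at h
        refine h.congr hT (fun t _ => unweight_add _ _ t) fun t _ => ?_
        beta_reduce; rw [unweight_add, unweight_add, map_add]; abel
      map_smul' := fun c g => by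
        refine (hKuniq _ _ ?_).symm
        have h := (hK g).const_smul c
        rw [smul_zero] at h
        refine h.congr hT (fun t _ => unweight_smul _ _ t) fun t _ => ?_
        simp only [RingHom.id_apply]
        rw [unweight_smul, unweight_smul, map_smul, smul_sub] }
  -- Closed graph: weighted convergence of data and solutions implies convergence of i v(t) and,
  -- because s^(μ−1) is integrable, of the integrals. The limit satisfies the integrated equation
  -- and is identified by uniqueness.
  have hKc : Continuous KL := by
    refine LinearMap.continuous_of_seq_closed_graph (𝕜 := ℝ) (E := vanishingAtZero T E₀)
      (F := vanishingAtZero T E₁) (g := KL) fun u g k hu hk => ?_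
    have hk' : Tendsto (fun n => K (u n)) atTop (𝓝 k) := hk
    refine hKuniq g k ⟨unweight_memBC _, (unweight_memBC _).sub ((unweight_memBC _).clm B),
      fun t ht => ?_⟩
    have hu0 := tendsto_iff_norm_sub_tendsto_zero.1 hu
    have hk0 := tendsto_iff_norm_sub_tendsto_zero.1 hk'
    have hint : ∀ (g : vanishingAtZero T E₀) (k : vanishingAtZero T E₁), IntervalIntegrable
        (fun s => unweight μ g s - B (unweight μ k s)) volume 0 t := fun g k =>
      ((unweight_memBC g).sub ((unweight_memBC k).clm B)).intervalIntegrable hμ le_rfl hT.le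
        ht.1.le ht.2
    have hpt : ∀ (k : vanishingAtZero T E₁) {s}, s ∈ Ioc 0 t →
        s ^ (1 - μ) * ‖unweight μ k s‖ ≤ ‖k‖ := fun k s hs =>
      rpow_mul_norm_unweight_le k ⟨hs.1, hs.2.trans ht.2⟩
    have hlim1 : Tendsto (fun n => i (unweight μ (K (u n)) t)) atTop (𝓝 (i (unweight μ k t))) := by
      refine (i.continuous.tendsto _).comp (tendsto_iff_norm_sub_tendsto_zero.2 ?_)
      have h2 := hk0.mul_const (t ^ (μ - 1))
      rw [zero_mul] at h2
      refine squeeze_zero (fun _ => norm_nonneg _) (fun n => ?_) h2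
      rw [← unweight_sub]
      exact norm_le_rpow_of_weight_le ht.1 (hpt _ ⟨ht.1, le_rfl⟩)
    have hlim2 : Tendsto (fun n => ∫ s in (0 : ℝ)..t, (unweight μ (u n) s -
        B (unweight μ (K (u n)) s))) atTop
        (𝓝 (∫ s in (0 : ℝ)..t, (unweight μ g s - B (unweight μ k s)))) := by
      refine tendsto_iff_norm_sub_tendsto_zero.2 ?_
      have h2 := ((hu0.add (hk0.const_mul ‖B‖)).mul_const (t ^ μ)).div_const μ
      rw [mul_zero, add_zero, zero_mul, zero_div] at h2
      refine squeeze_zero (fun _ => norm_nonneg _) (fun n => ?_) h2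
      rw [← intervalIntegral.integral_sub (hint _ _) (hint _ _)]
      refine norm_integral_le_of_weight_le hμ ht.1.le fun s hs => ?_
      have e : unweight μ (u n) s - B (unweight μ (K (u n)) s) -
          (unweight μ g s - B (unweight μ k s)) =
          unweight μ (u n - g) s - B (unweight μ (K (u n) - k) s) := by
        rw [unweight_sub, unweight_sub, map_sub]; abel
      rw [e]
      have hs0 : 0 ≤ s ^ (1 - μ) := Real.rpow_nonneg hs.1.le _
      calc _ ≤ s ^ (1 - μ) * (‖unweight μ (u n - g) s‖ +
            ‖B‖ * ‖unweight μ (K (u n) - k) s‖) := by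
            gcongr
            exact (norm_sub_le _ _).trans (by gcongr; exact B.le_opNorm _)
        _ = s ^ (1 - μ) * ‖unweight μ (u n - g) s‖ +
            ‖B‖ * (s ^ (1 - μ) * ‖unweight μ (K (u n) - k) s‖) := by ring
        _ ≤ _ := by
            gcongr
            · exact rpow_mul_norm_unweight_le _ ⟨hs.1, hs.2.trans ht.2⟩
            · exact hpt _ hs
    refine tendsto_nhds_unique hlim1 ?_
    rw [zero_add]
    refine hlim2.congr fun n => ?_
    rw [(hK (u n)).3 t ht, zero_add]
  obtain ⟨C, hC, hKC⟩ := SemilinearMapClass.bound_of_continuous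
    (E := vanishingAtZero T E₀) (F := vanishingAtZero T E₁) (σ₁₂ := RingHom.id ℝ) KL hKc
  refine ⟨C, hC.le, fun f hf => ?_⟩
  obtain ⟨g, hg⟩ := hf.exists_unweight_eqOn hμ1
  refine ⟨unweight μ (K g), (hK g).congr hT (fun _ _ => rfl) fun t ht => by beta_reduce; rw [hg ht],
    fun M hM t ht => ?_⟩
  have hM0 : 0 ≤ M :=
    (mul_nonneg (Real.rpow_nonneg ht.1.le _) (norm_nonneg _)).trans (hM t ht)
  have h1 : ‖g‖ ≤ M := norm_le_of_unweight (μ := μ) g hM0 fun t ht => by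
    rw [hg ht]; exact hM t ht
  calc _ ≤ ‖K g‖ := rpow_mul_norm_unweight_le _ ht
    _ ≤ C * ‖g‖ := hKC g
    _ ≤ _ := by gcongr

/-- Maximal regularity at level `μ` implies maximal regularity at every level `ν ≥ μ`, with
estimates that are uniform with respect to the length of the interval. -/
theorem exists_linear_estimate (hi : Function.Injective i) (hμ : 0 < μ) (hμν : μ ≤ ν)
    (hν1 : ν < 1) (hB : B ∈ maxReg i μ) :
    ∃ T > 0, ∃ C > 0, ∀ δ > 0, δ ≤ T →
      (∀ f, MemBC ν δ f → ∀ x ∈ interpSpace i ν,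
        ∃ v, IsPrimitive i ν δ x v (fun t => f t - B (v t))) ∧
      (∀ f x v, MemBC ν δ f → IsPrimitive i ν δ x v (fun t => f t - B (v t)) →
        ∀ M, (∀ t ∈ Ioc 0 δ, t ^ (1 - ν) * ‖f t‖ ≤ M) → ∀ t ∈ Ioc 0 δ,
          t ^ (1 - ν) * ‖v t‖ ≤ C * (M + interpNorm i ν x) ∧
          t ^ (1 - ν) * ‖f t - B (v t)‖ ≤ C * (M + interpNorm i ν x) ∧
          interpNorm i ν (i (v t) - x) ≤ C * (M + interpNorm i ν x)) := by
  have hμ1 := hμν.trans_lt hν1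
  have hν := hμ.trans_le hμν
  obtain ⟨T, hT, huniq, C, hC, hbound⟩ := exists_bound_of_mem_maxReg hi hμ hμ1 hB
  -- With w an extension of x and g its derivative, v − w has zero trace and source f − B w − g, of
  -- size at most M + 24(‖B‖ + 1)|x|. Thus D bounds v, D' also f − B v, and D'' also the
  -- E_ν-distance, through the trace estimate.
  set D := C * (1 + 24 * (‖B‖ + 1)) + 24 with hD
  set D' := 1 + (1 + ‖B‖) * D with hD'
  have hD0 : 0 ≤ D := by positivity
  have hDD' : D ≤ D' := by rw [hD']; nlinarith [mul_nonneg (norm_nonneg B) hD0]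
  have hD'0 : 0 < D' := by positivity
  set D'' := (1 + (1 / ν + 2)) * D' with hD''
  have hD'D'' : D' ≤ D'' := by
    rw [hD'']; exact le_mul_of_one_le_left hD'0.le (le_add_of_nonneg_right (by positivity))
  refine ⟨T, hT, D'', by positivity, fun δ hδ hδT => ⟨fun f hf x hx => ?_,
    fun f x v hf hv M hM => ?_⟩⟩
  · obtain ⟨w, g, hw, -⟩ := exists_isPrimitive_of_mem_interpSpace hν hν1 hx δ
    set f' : ℝ → E₀ := fun t => f t - B (w t) - g t with hf'
    have hf'BC : MemBC ν δ f' := (hf.sub (hw.1.clm B)).sub hw.2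
    obtain ⟨e, hef, he⟩ := (hf'BC.anti_weight hμν).exists_extend hδ
    obtain ⟨z, hz, -⟩ := hbound e (he T).1
    have hz' : IsPrimitive i μ δ 0 z (fun t => f' t - B (z t)) :=
      (hz.mono_right hδT).congr hδ (fun _ _ => rfl) fun t ht => by beta_reduce; rw [hef ht]
    -- So far z has only weight μ. Its decay at weight ν comes from the a priori estimate on (0, t],
    -- where the bound for f' is arbitrarily small; C + 1 avoids division by zero.
    have hzν : MemBC ν δ z := by
      refine memBC_of_forall_le hz'.1.1 fun ε hε => ?_
      obtain ⟨r, hr, Hr⟩ := hf'BC.exists_le (show 0 < ε / (C + 1) by positivity)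
      refine ⟨min r δ, lt_min hr hδ, fun t ht h => ?_⟩
      have htδ := h.trans (min_le_right _ _)
      refine (weight_le_of_isPrimitive_zero hμ hμν huniq hbound ht (htδ.trans hδT)
        ((hf'BC.anti_weight hμν).mono_right htδ) (hz'.mono_right htδ)
        (fun s hs => Hr s hs.1 (hs.2.trans (h.trans (min_le_left _ _))))).trans ?_
      rw [mul_div_assoc', div_le_iff₀ (by positivity)]
      nlinarith
    have hz'' : IsPrimitive i ν δ 0 z (fun t => f' t - B (z t)) :=
      ⟨hzν, hf'BC.sub (hzν.clm B), hz'.3⟩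
    have h := hw.add hν hz''
    rw [add_zero] at h
    exact ⟨_, h.congr hδ (fun _ _ => rfl) fun t _ => by rw [hf']; beta_reduce; rw [map_add]; abel⟩
  · have hN := interpNorm_nonneg i ν x
    have hx : x ∈ interpSpace i ν := hv.mem_interpSpace hν hδ
    have hM0 : 0 ≤ M := (mul_nonneg (Real.rpow_nonneg hδ.le _) (norm_nonneg _)).trans
      (hM δ ⟨hδ, le_rfl⟩)
    obtain ⟨w, g, hw, hwg⟩ := exists_isPrimitive_of_mem_interpSpace hν hν1 hx δ
    set f' : ℝ → E₀ := fun t => f t - B (w t) - g t with hf'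
    have hf'BC : MemBC ν δ f' := (hf.sub (hw.1.clm B)).sub hw.2
    have hz := hv.sub hν hw
    rw [sub_self] at hz
    have hz' : IsPrimitive i ν δ 0 (fun t => v t - w t) (fun t => f' t - B (v t - w t)) :=
      hz.congr hδ (fun _ _ => rfl) fun t _ => by rw [hf']; beta_reduce; rw [map_sub]; abel
    have hBle : ∀ (a : E₁) {t : ℝ}, 0 < t → t ^ (1 - ν) * ‖B a‖ ≤ ‖B‖ * (t ^ (1 - ν) * ‖a‖) :=
      fun a t ht => by
        have := mul_le_mul_of_nonneg_left (B.le_opNorm a) (Real.rpow_nonneg ht.le (1 - ν))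
        linarith
    have htri : ∀ (a b : E₀) {t : ℝ}, 0 < t →
        t ^ (1 - ν) * ‖a - b‖ ≤ t ^ (1 - ν) * ‖a‖ + t ^ (1 - ν) * ‖b‖ := fun a b t ht => by
      rw [← mul_add]
      exact mul_le_mul_of_nonneg_left (norm_sub_le _ _) (Real.rpow_nonneg ht.le _)
    have hf'M : ∀ t ∈ Ioc 0 δ,
        t ^ (1 - ν) * ‖f' t‖ ≤ M + 24 * (‖B‖ + 1) * interpNorm i ν x := fun t ht => by
      have h1 := htri (f t - B (w t)) (g t) ht.1
      have h2 := htri (f t) (B (w t)) ht.1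
      have h3 := hBle (w t) ht.1
      have h4 := mul_le_mul_of_nonneg_left (hwg t ht).1 (norm_nonneg B)
      have h5 := (hwg t ht).2
      have h6 := hM t ht
      rw [hf']; beta_reduce
      linarith
    have hvM : ∀ t ∈ Ioc 0 δ, t ^ (1 - ν) * ‖v t‖ ≤ D * (M + interpNorm i ν x) := fun t ht => by
      have h1 := weight_le_of_isPrimitive_zero hμ hμν huniq hbound ht.1 (ht.2.trans hδT)
        ((hf'BC.anti_weight hμν).mono_right ht.2) ((hz'.anti_weight hμν).mono_right ht.2)
        (fun s hs => hf'M s ⟨hs.1, hs.2.trans ht.2⟩)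
      have h2 : ‖v t‖ ≤ ‖v t - w t‖ + ‖w t‖ := by simpa using norm_add_le (v t - w t) (w t)
      have h3 := mul_le_mul_of_nonneg_left h2 (Real.rpow_nonneg ht.1.le (1 - ν))
      have h4 := (hwg t ht).1
      have h5 : C * (M + 24 * (‖B‖ + 1) * interpNorm i ν x) + 24 * interpNorm i ν x ≤
          D * (M + interpNorm i ν x) := by
        have : 0 ≤ C * (24 * (‖B‖ + 1)) * M + C * interpNorm i ν x + 24 * M := by positivity
        rw [hD]; nlinarith
      linarith
    have hgM : ∀ t ∈ Ioc 0 δ,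
        t ^ (1 - ν) * ‖f t - B (v t)‖ ≤ D' * (M + interpNorm i ν x) := fun t ht => by
      have h1 := htri (f t) (B (v t)) ht.1
      have h2 := hBle (v t) ht.1
      have h3 := mul_le_mul_of_nonneg_left (hvM t ht) (norm_nonneg B)
      have h4 := hM t ht
      have h5 : 0 ≤ D * (M + interpNorm i ν x) := by positivity
      rw [hD']
      linarith
    have hs0 : 0 ≤ M + interpNorm i ν x := by positivity
    have hDs := mul_le_mul_of_nonneg_right hDD' hs0
    have hDs' := mul_le_mul_of_nonneg_right hD'D'' hs0
    intro t ht
    refine ⟨((hvM t ht).trans hDs).trans hDs', (hgM t ht).trans hDs', ?_⟩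
    have h := hv.interpNorm_sub_le hν hν1 ht
      (fun s hs => (hvM s ⟨hs.1, hs.2.trans ht.2⟩).trans hDs)
      (fun s hs => hgM s ⟨hs.1, hs.2.trans ht.2⟩)
    refine h.trans ?_
    rw [hD'']
    have h0 : 0 ≤ D' * (M + interpNorm i ν x) := by positivity
    linarith

end Linear

/-! ### Uniqueness of E_μ-solutions -/

section Solution

variable {E₀ E₁ : Type*} [NormedAddCommGroup E₀] [NormedSpace ℝ E₀]
  [NormedAddCommGroup E₁] [NormedSpace ℝ E₁]
  {i : E₁ →L[ℝ] E₀} {μ ν β T : ℝ} {V : Set E₀} {A : E₀ → E₁ →L[ℝ] E₀} {F₁ F₂ : E₀ → E₀} {x : E₀}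
  {v v₁ v₂ : ℝ → E₁}

theorem IsPrimitive.tendsto_interpNorm_sub {g : ℝ → E₀} (hν : 0 < ν) (hν1 : ν < 1) (hT : 0 < T)
    (h : IsPrimitive i ν T x v g) :
    Tendsto (fun t => interpNorm i ν (i (v t) - x)) (𝓝[>] 0) (𝓝 0) :=
  tendsto_nhdsGT_zero_of_forall_le (fun _ _ => interpNorm_nonneg _ _ _) fun _ hε =>
    h.exists_interpNorm_sub_le hν hν1 hT hε

/-- Elements of `𝔼_{1,μ}` satisfy `t^{β-μ} |v(t)|_{E_β} → 0` for `β ∈ (μ,1)`. -/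
theorem IsPrimitive.tendsto_rpow_mul_interpNorm {g : ℝ → E₀} (hμ : 0 < μ) (hμβ : μ < β)
    (hβ1 : β < 1) (hT : 0 < T) (h : IsPrimitive i μ T x v g) :
    Tendsto (fun t => t ^ (β - μ) * interpNorm i β (i (v t))) (𝓝[>] 0) (𝓝 0) := by
  have hμ1 := hμβ.trans hβ1
  have hd : 0 < 1 - μ := by linarith
  have hx := h.mem_interpSpace hμ hT
  -- As t^(β−μ) = (t^(1−μ))^q and |v(t)|_{E_μ} is bounded near 0, interpolation reduces the claim to
  -- t^(1−μ)‖v(t)‖ → 0.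
  set q := (β - μ) / (1 - μ) with hq
  have hq0 : 0 < q := div_pos (by linarith) hd
  have hp0 : 0 ≤ (1 - β) / (1 - μ) := div_nonneg (by linarith) hd.le
  set N := (interpNorm i μ x + 1) ^ ((1 - β) / (1 - μ)) with hN
  have h1 : Tendsto (fun t : ℝ => N * (t ^ (1 - μ) * ‖v t‖) ^ q) (𝓝[>] 0) (𝓝 0) := by
    have h2 := (Real.continuousAt_rpow_const 0 q (Or.inr hq0.le)).tendsto
    rw [Real.zero_rpow hq0.ne'] at h2
    simpa using (h2.comp h.1.3).const_mul N
  refine tendsto_of_tendsto_of_tendsto_of_le_of_le' tendsto_const_nhds h1 ?_ ?_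
  · filter_upwards [self_mem_nhdsWithin] with t ht
    exact mul_nonneg (Real.rpow_nonneg (le_of_lt ht) _) (interpNorm_nonneg _ _ _)
  · filter_upwards [self_mem_nhdsWithin, (h.tendsto_interpNorm_sub hμ hμ1 hT).eventually
      (gt_mem_nhds one_pos)] with t ht h3
    have ht : 0 < t := ht
    have h4 : interpNorm i μ (i (v t)) ≤ interpNorm i μ x + 1 := by
      have := interpNorm_add_le hμ.le
        (sub_mem_interpSpace (apply_mem_interpSpace hμ1 (v t)) hx) hx
      rw [sub_add_cancel] at this
      linarith
    have h5 := interpNorm_apply_le_rpow_mul (i := i) hμ.le hμβ.le hμ1 hβ1.le (v t)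
    have h6 : t ^ (β - μ) = (t ^ (1 - μ)) ^ q := by
      rw [← Real.rpow_mul ht.le, hq]; congr 1; field_simp
    rw [Real.mul_rpow (Real.rpow_nonneg ht.le _) (norm_nonneg _), ← h6]
    calc _ ≤ t ^ (β - μ) * (N * ‖v t‖ ^ q) := by
          gcongr
          refine h5.trans ?_
          gcongr
          exact Real.rpow_le_rpow (interpNorm_nonneg _ _ _) h4 hp0
      _ = _ := by ring

/-- The exponent condition says ρ(β − μ) ≤ 1 − b, so for t ≤ 1 the product is at most (t^(β−μ)
φ(t))^ρ, which vanishes in the limit even in the case of equality. For ρ = 0 that power is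
constantly 1, and t^(1−b) supplies the decay. -/
theorem tendsto_rpow_mul_rpow {φ : ℝ → ℝ} {b ρ : ℝ} (hφ0 : ∀ t, 0 ≤ φ t)
    (hφ : Tendsto (fun t => t ^ (β - μ) * φ t) (𝓝[>] 0) (𝓝 0)) (hb : b < 1) (hρ : 0 ≤ ρ)
    (h : ρ * (β - μ) + (b - μ) ≤ 1 - μ) :
    Tendsto (fun t => t ^ (1 - b) * φ t ^ ρ) (𝓝[>] 0) (𝓝 0) := by
  rcases eq_or_lt_of_le hρ with rfl | hρ0
  · simpa using tendsto_rpow_nhdsGT_zero (sub_pos.2 hb)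
  · have h2 := (Real.continuousAt_rpow_const 0 ρ (Or.inr hρ0.le)).tendsto
    rw [Real.zero_rpow hρ0.ne'] at h2
    refine tendsto_of_tendsto_of_tendsto_of_le_of_le' tendsto_const_nhds (h2.comp hφ) ?_ ?_
    · filter_upwards [self_mem_nhdsWithin] with t ht
      exact mul_nonneg (Real.rpow_nonneg (le_of_lt ht) _) (Real.rpow_nonneg (hφ0 t) _)
    · filter_upwards [Ioc_mem_nhdsGT one_pos] with t ht
      simp only [Function.comp_apply]
      rw [Real.mul_rpow (Real.rpow_nonneg ht.1.le _) (hφ0 t), ← Real.rpow_mul ht.1.le]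
      gcongr ?_ * _
      · exact Real.rpow_nonneg (hφ0 t) _
      · exact Real.rpow_le_rpow_of_exponent_ge ht.1 ht.2 (by linarith)

/-- Interpolate and distribute 1 − μ = (1 − b) + (b − μ) among the powers of t. The spare factor
t^(1−b) is what absorbs the powers of E_β-norms in the bound for F₂. -/
theorem interpNorm_apply_le_of_weight_le {b K t : ℝ} (hμ : 0 < μ) (hμ1 : μ < 1) (hμb : μ ≤ b)
    (hb1 : b ≤ 1) {a : E₁} (ht : 0 < t) (h1 : t ^ (1 - μ) * ‖a‖ ≤ K)
    (h2 : interpNorm i μ (i a) ≤ K) : t ^ (1 - μ) * interpNorm i b (i a) ≤ t ^ (1 - b) * K := by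
  have hd : 0 < 1 - μ := by linarith
  have hK : 0 ≤ K := (interpNorm_nonneg _ _ _).trans h2
  have hp0 : 0 ≤ (1 - b) / (1 - μ) := div_nonneg (by linarith) hd.le
  have hq0 : 0 ≤ (b - μ) / (1 - μ) := div_nonneg (by linarith) hd.le
  have h3 := interpNorm_apply_le_rpow_mul (i := i) hμ.le hμb hμ1 hb1 a
  have h4 : t ^ (1 - μ) = t ^ (1 - b) * (t ^ (1 - μ)) ^ ((b - μ) / (1 - μ)) := by
    rw [← Real.rpow_mul ht.le, ← Real.rpow_add ht]; congr 1; field_simp; ring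
  calc _ ≤ t ^ (1 - μ) * (interpNorm i μ (i a) ^ ((1 - b) / (1 - μ)) *
        ‖a‖ ^ ((b - μ) / (1 - μ))) := by gcongr
    _ = t ^ (1 - b) * (interpNorm i μ (i a) ^ ((1 - b) / (1 - μ)) *
        (t ^ (1 - μ) * ‖a‖) ^ ((b - μ) / (1 - μ))) := by
        rw [Real.mul_rpow (Real.rpow_nonneg ht.le _) (norm_nonneg _)]
        nth_rewrite 1 [h4]
        ring
    _ ≤ t ^ (1 - b) * (K ^ ((1 - b) / (1 - μ)) * K ^ ((b - μ) / (1 - μ))) := by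
        gcongr
        exact interpNorm_nonneg _ _ _
    _ = _ := by
        rw [← Real.rpow_add_of_nonneg hK hp0 hq0]
        have : (1 - b) / (1 - μ) + (b - μ) / (1 - μ) = 1 := by field_simp; ring
        rw [this, Real.rpow_one]

variable [CompleteSpace E₀]

/-- `timeDeriv` is taken within (0, T] and so refers to T; the derivative g does not, and can be
restricted and shifted freely. -/
theorem isSolution_iff_exists (hν : 0 < ν) (hT : 0 < T) :
    IsSolution i ν T V A F₁ F₂ x v ↔ x ∈ V ∧ ∃ g, IsPrimitive i ν T x v g ∧
      ∀ t ∈ Ioc 0 T, i (v t) ∈ V ∧ g t + A (i (v t)) (v t) = F₁ (i (v t)) + F₂ (i (v t)) := by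
  constructor
  · rintro ⟨h1, h2, h3, h4⟩
    exact ⟨h2, _, h1.isPrimitive hν h3, h4⟩
  · rintro ⟨h2, g, hg, h⟩
    exact ⟨hg.memE1 hν hT, h2, hg.hasTrace hν hT, fun t ht => by
      rw [hg.timeDeriv_eq hν ht]; exact h t ht⟩

theorem IsSolution.mono_right (hν : 0 < ν) (h : IsSolution i ν T V A F₁ F₂ x v) {T' : ℝ}
    (hT' : 0 < T') (hTT' : T' ≤ T) : IsSolution i ν T' V A F₁ F₂ x v := by
  obtain ⟨hx, g, hg, H⟩ := (isSolution_iff_exists hν (hT'.trans_le hTT')).1 h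
  exact (isSolution_iff_exists hν hT').2 ⟨hx, g, hg.mono_right hTT', fun t ht =>
    H t ⟨ht.1, ht.2.trans hTT'⟩⟩

theorem IsSolution.anti_weight (hμ : 0 < μ) (hμν : μ ≤ ν) (hT : 0 < T)
    (h : IsSolution i ν T V A F₁ F₂ x v) : IsSolution i μ T V A F₁ F₂ x v := by
  obtain ⟨hx, g, hg, H⟩ := (isSolution_iff_exists (hμ.trans_le hμν) hT).1 h
  exact (isSolution_iff_exists hμ hT).2 ⟨hx, g, hg.anti_weight hμν, H⟩

theorem IsSolution.shift (hν : 0 < ν) (hν1 : ν < 1) (h : IsSolution i ν T V A F₁ F₂ x v) {s : ℝ}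
    (hs : 0 < s) (hsT : s < T) :
    IsSolution i ν (T - s) V A F₁ F₂ (i (v s)) (fun t => v (t + s)) := by
  obtain ⟨hx, g, hg, H⟩ := (isSolution_iff_exists hν (hs.trans hsT)).1 h
  exact (isSolution_iff_exists hν (sub_pos.2 hsT)).2 ⟨(H s ⟨hs, hsT.le⟩).1, _,
    hg.shift hν hν1 hs hsT, fun t ht => H (t + s) ⟨by linarith [ht.1], by linarith [ht.2]⟩⟩

/-- A solution which agrees near `t = 0` with one of higher weight has that weight as well. -/
theorem IsSolution.of_eqOn (hμ : 0 < μ) (hν : 0 < ν) {τ : ℝ} (hτ : 0 < τ) (hT : 0 < T)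
    (h₁ : IsSolution i μ T V A F₁ F₂ x v₁) (h₂ : IsSolution i ν τ V A F₁ F₂ x v₂)
    (h : EqOn v₁ v₂ (Ioc 0 (min T τ))) : IsSolution i ν T V A F₁ F₂ x v₁ := by
  obtain ⟨hx, g₁, hg₁, H₁⟩ := (isSolution_iff_exists hμ hT).1 h₁
  obtain ⟨-, g₂, hg₂, H₂⟩ := (isSolution_iff_exists hν hτ).1 h₂
  have hm : 0 < min T τ := lt_min hT hτ
  -- The equation determines the derivative from the solution. Only the limits at 0 then remain to
  -- be transferred.
  have hg : EqOn g₁ g₂ (Ioc 0 (min T τ)) := fun t ht => by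
    have a := (H₁ t ⟨ht.1, ht.2.trans (min_le_left _ _)⟩).2
    have b := (H₂ t ⟨ht.1, ht.2.trans (min_le_right _ _)⟩).2
    rw [h ht, ← b] at a
    exact add_right_cancel a
  refine (isSolution_iff_exists hν hT).2 ⟨hx, g₁, ⟨memBC_of_tendsto hg₁.1.1 ?_,
    memBC_of_tendsto hg₁.2.1 ?_, hg₁.3⟩, H₁⟩
  · refine hg₂.1.3.congr' ?_
    filter_upwards [Ioc_mem_nhdsGT hm] with t ht
    rw [h ht]
  · refine hg₂.2.3.congr' ?_
    filter_upwards [Ioc_mem_nhdsGT hm] with t ht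
    rw [hg ht]

variable [CompleteSpace E₁]

/-- Two `E_μ`-solutions with the same initial value agree for small times. -/
theorem IsSolution.exists_eqOn (hi : Function.Injective i) (hμ : 0 < μ) (hμβ : μ < β) (hβ1 : β < 1)
    (hAF₁ : LocLipCoefficients i μ V A F₁) (hF₂ : SingularStructure i μ β V F₂)
    (hT : 0 < T) (h₁ : IsSolution i μ T V A F₁ F₂ x v₁)
    (h₂ : IsSolution i μ T V A F₁ F₂ x v₂) : ∃ δ > 0, δ ≤ T ∧ EqOn v₁ v₂ (Ioc 0 δ) := by
  have hμ1 := hμβ.trans hβ1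
  obtain ⟨hx, g₁, hg₁, H₁⟩ := (isSolution_iff_exists hμ hT).1 h₁
  obtain ⟨-, g₂, hg₂, H₂⟩ := (isSolution_iff_exists hμ hT).1 h₂
  set B := A x with hB
  obtain ⟨T₀, hT₀, C, hC, hlin⟩ := exists_linear_estimate hi hμ le_rfl hμ1 (hAF₁.1 x hx)
  obtain ⟨r, hr, L, hL⟩ := hAF₁.2 x hx
  obtain ⟨m, b, ρ, hbρ, hF⟩ := hF₂
  obtain ⟨K, hK, hF⟩ := hF x hx 1 one_pos
  have hN₁ := hg₁.tendsto_interpNorm_sub hμ hμ1 hT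
  have hN₂ := hg₂.tendsto_interpNorm_sub hμ hμ1 hT
  set S : ℝ → ℝ := fun t => ∑ j, (t ^ (1 - b j) * (1 : ℝ) +
    t ^ (1 - b j) * interpNorm i β (i (v₁ t)) ^ ρ j +
    t ^ (1 - b j) * interpNorm i β (i (v₂ t)) ^ ρ j) with hS
  have hSlim : Tendsto S (𝓝[>] 0) (𝓝 0) := by
    have : Tendsto S (𝓝[>] 0) (𝓝 (∑ j : Fin m, (0 * 1 + 0 + 0))) := by
      refine tendsto_finsetSum _ fun j _ => ?_
      obtain ⟨⟨hb1, hb2⟩, hρ, hbρ⟩ := hbρ j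
      rw [div_le_one (by linarith)] at hbρ
      have hb1 : b j < 1 := hb2.trans_lt hβ1
      exact (((tendsto_rpow_nhdsGT_zero (sub_pos.2 hb1)).mul_const 1).add
        (tendsto_rpow_mul_rpow (fun _ => interpNorm_nonneg _ _ _)
          (hg₁.tendsto_rpow_mul_interpNorm hμ hμβ hβ1 hT) hb1 hρ hbρ)).add
        (tendsto_rpow_mul_rpow (fun _ => interpNorm_nonneg _ _ _)
          (hg₂.tendsto_rpow_mul_interpNorm hμ hμβ hβ1 hT) hb1 hρ hbρ)
    simpa using this
  -- C comes from the linear estimate; the four terms correspond to A(x) − A(v₁), (A(v₁) − A(v₂))v₂,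
  -- F₁ and F₂.
  set κ : ℝ → ℝ := fun t => C * (|L| * interpNorm i μ (i (v₁ t) - x) +
    |L| * (t ^ (1 - μ) * ‖v₂ t‖) + |L| * t ^ (1 - μ) + K * S t) with hκ
  have hκlim : Tendsto κ (𝓝[>] 0) (𝓝 0) := by
    have := ((((hN₁.const_mul |L|).add (hg₂.1.3.const_mul |L|)).add
      ((tendsto_rpow_nhdsGT_zero (sub_pos.2 hμ1)).const_mul |L|)).add
      (hSlim.const_mul K)).const_mul C
    simpa using this
  obtain ⟨δ', hδ', hδ⟩ := mem_nhdsGT_iff_exists_Ioc_subset.1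
    (((hN₁.eventually (gt_mem_nhds (lt_min hr one_pos))).and
      (hN₂.eventually (gt_mem_nhds (lt_min hr one_pos)))).and
      (hκlim.eventually (gt_mem_nhds one_half_pos)))
  set δ := min δ' (min T T₀) with hδdef
  have hδ0 : 0 < δ := lt_min hδ' (lt_min hT hT₀)
  have hδT : δ ≤ T := (min_le_right _ _).trans (min_le_left _ _)
  have hδT₀ : δ ≤ T₀ := (min_le_right _ _).trans (min_le_right _ _)
  set w : ℝ → E₁ := fun t => v₁ t - v₂ t with hw
  set h : ℝ → E₀ := fun t => g₁ t - g₂ t + B (w t) with hh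
  have hP := (hg₁.sub hμ hg₂).mono_right hδT
  rw [sub_self] at hP
  have hhBC : MemBC μ δ h := hP.2.add (hP.1.clm B)
  have hP' : IsPrimitive i μ δ 0 w (fun t => h t - B (w t)) :=
    hP.congr hδ0 (fun _ _ => rfl) fun t _ => by
      rw [hh]; beta_reduce; rw [add_sub_cancel_right]
  have hest := (hlin δ hδ0 hδT₀).2 h 0 w hhBC hP'
  simp only [interpNorm_zero, add_zero, sub_zero] at hest
  -- The difference w solves w' + B w = h with zero initial value, so a bound M for h bounds w by C
  -- M; inserted into the two equations this returns κ(t) M ≤ M/2. Iteration gives h = 0, then w =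
  -- 0.
  have himp : ∀ M, (∀ t ∈ Ioc 0 δ, t ^ (1 - μ) * ‖h t‖ ≤ M) →
      ∀ t ∈ Ioc 0 δ, t ^ (1 - μ) * ‖h t‖ ≤ M / 2 := by
    intro M hM t ht
    have htT : t ∈ Ioc 0 T := ⟨ht.1, ht.2.trans hδT⟩
    have hM0 : 0 ≤ M := (mul_nonneg (Real.rpow_nonneg ht.1.le _) (norm_nonneg _)).trans (hM t ht)
    obtain ⟨hw1, -, hw2⟩ := hest M hM t ht
    obtain ⟨⟨hr₁, hr₂⟩, hκt⟩ : (_ ∧ _) ∧ _ := hδ ⟨ht.1, ht.2.trans (min_le_left _ _)⟩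
    obtain ⟨hV₁, he₁⟩ := H₁ t htT
    obtain ⟨hV₂, he₂⟩ := H₂ t htT
    have hmem : ∀ a : E₁, i a ∈ interpSpace i μ := fun a => apply_mem_interpSpace hμ1 a
    have hpt : 0 ≤ t ^ (1 - μ) := Real.rpow_nonneg ht.1.le _
    have hLle : ∀ a : E₀, L * interpNorm i μ a ≤ |L| * interpNorm i μ a := fun a =>
      mul_le_mul_of_nonneg_right (le_abs_self L) (interpNorm_nonneg _ _ _)
    have hx0 : interpNorm i μ (x - x) < r := by rw [sub_self, interpNorm_zero]; exact hr
    have hr₁' := hr₁.trans_le (min_le_left _ _)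
    have hr₂' := hr₂.trans_le (min_le_left _ _)
    have hA₁ := ((hL x hx _ hV₁ hx0 hr₁').1).trans (hLle _)
    rw [interpNorm_sub_comm] at hA₁
    obtain ⟨hA₂, hF₁⟩ := hL _ hV₁ _ hV₂ hr₁' hr₂'
    have hA₂ := hA₂.trans (hLle _)
    have hF₁ := hF₁.trans (hLle _)
    have hF₂ := hF _ ⟨⟨hmem _, hr₁.le.trans (min_le_right _ _)⟩, hV₁, apply_mem_interpSpace hβ1 _⟩
      _ ⟨⟨hmem _, hr₂.le.trans (min_le_right _ _)⟩, hV₂, apply_mem_interpSpace hβ1 _⟩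
    have hiw : i (v₁ t) - i (v₂ t) = i (w t) := by rw [hw, map_sub]
    rw [hiw] at hA₂ hF₁ hF₂
    have hdec : h t = (B - A (i (v₁ t))) (w t) - (A (i (v₁ t)) - A (i (v₂ t))) (v₂ t) +
        (F₁ (i (v₁ t)) - F₁ (i (v₂ t))) + (F₂ (i (v₁ t)) - F₂ (i (v₂ t))) := by
      have a := eq_sub_of_add_eq he₁
      have c := eq_sub_of_add_eq he₂
      rw [hh]; beta_reduce
      rw [a, c, hw]
      simp only [_root_.sub_apply, map_sub]
      abel
    have hsum : t ^ (1 - μ) * ∑ j, (1 + interpNorm i β (i (v₁ t)) ^ ρ j +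
        interpNorm i β (i (v₂ t)) ^ ρ j) * interpNorm i (b j) (i (w t)) ≤ S t * (C * M) := by
      rw [hS, Finset.mul_sum, Finset.sum_mul]
      refine Finset.sum_le_sum fun j _ => ?_
      obtain ⟨⟨hb1, hb2⟩, -, -⟩ := hbρ j
      have h5 := interpNorm_apply_le_of_weight_le hμ hμ1 hb1 (hb2.trans hβ1.le) ht.1 hw1 hw2
      have h6 : 0 ≤ 1 + interpNorm i β (i (v₁ t)) ^ ρ j + interpNorm i β (i (v₂ t)) ^ ρ j := by
        have a := Real.rpow_nonneg (interpNorm_nonneg i β (i (v₁ t))) (ρ j)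
        have b := Real.rpow_nonneg (interpNorm_nonneg i β (i (v₂ t))) (ρ j)
        linarith
      have := mul_le_mul_of_nonneg_left h5 h6
      linarith
    have h7 : t ^ (1 - μ) * ‖(B - A (i (v₁ t))) (w t)‖ ≤
        |L| * interpNorm i μ (i (v₁ t) - x) * (C * M) := by
      have a := (ContinuousLinearMap.le_opNorm (B - A (i (v₁ t))) (w t)).trans
        (mul_le_mul_of_nonneg_right hA₁ (norm_nonneg _))
      have c := mul_le_mul_of_nonneg_left a hpt
      have d := mul_le_mul_of_nonneg_left hw1
        (mul_nonneg (abs_nonneg L) (interpNorm_nonneg i μ (i (v₁ t) - x)))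
      linarith
    have h8 : t ^ (1 - μ) * ‖(A (i (v₁ t)) - A (i (v₂ t))) (v₂ t)‖ ≤
        |L| * (t ^ (1 - μ) * ‖v₂ t‖) * (C * M) := by
      have a := (ContinuousLinearMap.le_opNorm (A (i (v₁ t)) - A (i (v₂ t))) (v₂ t)).trans
        (mul_le_mul_of_nonneg_right hA₂ (norm_nonneg _))
      have c := mul_le_mul_of_nonneg_left a hpt
      have d := mul_le_mul_of_nonneg_left hw2
        (mul_nonneg (abs_nonneg L) (mul_nonneg hpt (norm_nonneg (v₂ t))))
      linarith
    have h9 : t ^ (1 - μ) * ‖F₁ (i (v₁ t)) - F₁ (i (v₂ t))‖ ≤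
        |L| * t ^ (1 - μ) * (C * M) := by
      have c := mul_le_mul_of_nonneg_left hF₁ hpt
      have d := mul_le_mul_of_nonneg_left hw2 (mul_nonneg (abs_nonneg L) hpt)
      linarith
    have h10 : t ^ (1 - μ) * ‖F₂ (i (v₁ t)) - F₂ (i (v₂ t))‖ ≤ K * S t * (C * M) := by
      have c := mul_le_mul_of_nonneg_left hF₂ hpt
      have d := mul_le_mul_of_nonneg_left hsum hK.le
      linarith
    have h11 : ‖h t‖ ≤ ‖(B - A (i (v₁ t))) (w t)‖ + ‖(A (i (v₁ t)) - A (i (v₂ t))) (v₂ t)‖ +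
        ‖F₁ (i (v₁ t)) - F₁ (i (v₂ t))‖ + ‖F₂ (i (v₁ t)) - F₂ (i (v₂ t))‖ := by
      rw [hdec]
      exact (norm_add₃_le).trans (by gcongr; exact norm_sub_le _ _)
    have h12 : t ^ (1 - μ) * ‖h t‖ ≤ κ t * M := by
      have := mul_le_mul_of_nonneg_left h11 hpt
      rw [hκ]
      linarith
    have h13 := mul_le_mul_of_nonneg_right (le_of_lt hκt) hM0
    linarith
  obtain ⟨M₀, hM₀⟩ := hhBC.2
  have hiter : ∀ n : ℕ, ∀ t ∈ Ioc 0 δ, t ^ (1 - μ) * ‖h t‖ ≤ M₀ * (1 / 2) ^ n := by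
    intro n
    induction n with
    | zero => simpa using hM₀
    | succ n ih =>
      intro t ht
      have := himp _ ih t ht
      rw [pow_succ]
      linarith
  have hzero : ∀ t ∈ Ioc 0 δ, t ^ (1 - μ) * ‖h t‖ ≤ 0 := fun t ht => by
    have hlim : Tendsto (fun n : ℕ => M₀ * (1 / 2 : ℝ) ^ n) atTop (𝓝 0) := by
      simpa using (tendsto_pow_atTop_nhds_zero_of_lt_one (r := (1 / 2 : ℝ)) (by norm_num)
        (by norm_num)).const_mul M₀
    exact ge_of_tendsto' hlim fun n => hiter n t ht
  refine ⟨δ, hδ0, hδT, fun t ht => ?_⟩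
  have h1 := (hest 0 hzero t ht).1
  rw [mul_zero] at h1
  have h2 : ‖w t‖ ≤ 0 := nonpos_of_mul_nonpos_right h1 (Real.rpow_pos_of_pos ht.1 _)
  exact sub_eq_zero.1 (norm_le_zero_iff.1 h2)

/-- Uniqueness of `E_μ`-solutions. -/
theorem IsSolution.eqOn (hi : Function.Injective i) (hμ : 0 < μ) (hμβ : μ < β) (hβ1 : β < 1)
    (hAF₁ : LocLipCoefficients i μ V A F₁) (hF₂ : SingularStructure i μ β V F₂)
    (hT : 0 < T) (h₁ : IsSolution i μ T V A F₁ F₂ x v₁)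
    (h₂ : IsSolution i μ T V A F₁ F₂ x v₂) : EqOn v₁ v₂ (Ioc 0 T) := by
  obtain ⟨δ, hδ, hδT, hloc⟩ := h₁.exists_eqOn hi hμ hμβ hβ1 hAF₁ hF₂ hT h₂
  have hsub : Icc δ T ⊆ Ioc 0 T := fun t ht => ⟨hδ.trans_le ht.1, ht.2⟩
  have hclosed : IsClosed ({t | v₁ t = v₂ t} ∩ Icc δ T) := by
    have h : ContinuousOn (fun t => v₁ t - v₂ t) (Icc δ T) :=
      (h₁.1.4.1.sub h₂.1.4.1).mono hsub
    have := h.preimage_isClosed_of_isClosed isClosed_Icc (isClosed_singleton (x := (0 : E₁)))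
    convert this using 1
    ext t
    simp [sub_eq_zero, and_comm]
  -- At a time s of agreement both solutions restart from the same value in V, so local uniqueness
  -- carries the agreement past s.
  have hIcc := hclosed.Icc_subset_of_forall_mem_nhdsWithin (hloc ⟨hδ, le_rfl⟩) fun s hs => by
    have hs0 : 0 < s := hδ.trans_le hs.2.1
    have a₁ := h₁.shift hμ (hμβ.trans hβ1) hs0 hs.2.2
    have a₂ := h₂.shift hμ (hμβ.trans hβ1) hs0 hs.2.2
    rw [← show v₁ s = v₂ s from hs.1] at a₂
    obtain ⟨η, hη, -, he⟩ :=
      a₁.exists_eqOn hi hμ hμβ hβ1 hAF₁ hF₂ (sub_pos.2 hs.2.2) a₂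
    filter_upwards [Ioc_mem_nhdsGT (show s < s + η by linarith)] with t ht
    have := he (show t - s ∈ Ioc 0 η from ⟨by linarith [ht.1], by linarith [ht.2]⟩)
    simpa using this
  intro t ht
  rcases le_total t δ with h | h
  · exact hloc ⟨ht.1, h⟩
  · exact hIcc ⟨h, ht.2⟩

end Solution

/-! ### Existence at weight ν by contraction -/

section Existence

/-- Invariance and contraction are required on the ball only; outside it the map used below takes
default values. -/
theorem exists_fixedPoint_closedBall {Z : Type*} [NormedAddCommGroup Z] [CompleteSpace Z]
    {G : Z → Z} {ε : ℝ} (hε : 0 ≤ ε) (hmaps : ∀ f, ‖f‖ ≤ ε → ‖G f‖ ≤ ε)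
    (hlip : ∀ f g, ‖f‖ ≤ ε → ‖g‖ ≤ ε → ‖G f - G g‖ ≤ 1 / 2 * ‖f - g‖) :
    ∃ f, ‖f‖ ≤ ε ∧ G f = f := by
  have hmaps' : MapsTo G (Metric.closedBall 0 ε) (Metric.closedBall 0 ε) := fun f hf => by
    rw [mem_closedBall_zero_iff] at hf ⊢
    exact hmaps f hf
  have hcontr : ContractingWith (1 / 2) (hmaps'.restrict G _ _) := by
    refine ⟨by norm_num, LipschitzWith.of_dist_le_mul fun f g => ?_⟩
    have := hlip f g (mem_closedBall_zero_iff.1 f.2) (mem_closedBall_zero_iff.1 g.2)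
    rw [Subtype.dist_eq, Subtype.dist_eq, dist_eq_norm, dist_eq_norm]
    simpa using this
  obtain ⟨f, hf, hfix, -⟩ := hcontr.exists_fixedPoint' Metric.isClosed_closedBall.isComplete
    hmaps' (x := 0) (by simpa using hε) (edist_ne_top _ _)
  exact ⟨f, mem_closedBall_zero_iff.1 hf, hfix⟩

variable {E₀ E₁ : Type*} [NormedAddCommGroup E₀] [NormedSpace ℝ E₀]
  [NormedAddCommGroup E₁] [NormedSpace ℝ E₁]
  {i : E₁ →L[ℝ] E₀} {μ ν β T : ℝ} {V : Set E₀} {A : E₀ → E₁ →L[ℝ] E₀} {F F₁ F₂ : E₀ → E₀}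
  {x x₀ : E₀}

/-- For `ν ≥ β` the coefficients are locally Lipschitz continuous on `V ∩ E_ν` in the norm of
`E_ν`. -/
theorem exists_lipschitz_coefficients (hμ : 0 < μ) (hμβ : μ < β) (hβν : β ≤ ν)
    (hV : IsOpenInterp i μ V) (hAF₁ : LocLipCoefficients i μ V A F₁)
    (hF₂ : SingularStructure i μ β V F₂) (hx₀ : x₀ ∈ V ∩ interpSpace i ν) :
    ∃ r > 0, ∃ L ≥ 0, (∀ y ∈ closedBallInterp i ν x₀ r, y ∈ V) ∧
      ∀ y ∈ closedBallInterp i ν x₀ r, ∀ z ∈ closedBallInterp i ν x₀ r,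
        ‖A y - A z‖ ≤ L * interpNorm i ν (y - z) ∧
        ‖(F₁ y + F₂ y) - (F₁ z + F₂ z)‖ ≤ L * interpNorm i ν (y - z) := by
  obtain ⟨hxV, hxν⟩ := hx₀
  have hμν := hμβ.le.trans hβν
  have hν := hμ.trans_le hμν
  set c := 1 + ‖i‖ with hc
  have hc0 : 0 < c := by positivity
  obtain ⟨r₁, hr₁, H₁⟩ := hV.2 x₀ hxV
  obtain ⟨r₂, hr₂, L, H₂⟩ := hAF₁.2 x₀ hxV
  obtain ⟨m, b, ρ, hbρ, hF⟩ := hF₂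
  obtain ⟨K, hK, hF⟩ := hF x₀ hxV 1 one_pos
  -- Since c r < min(r₁, r₂, 1), the E_ν-ball of radius r lies in the E_μ-balls on which openness of
  -- V, the Lipschitz bounds and the F₂-estimate with R = 1 apply.
  set r := min (min r₁ r₂) 1 / (2 * c) with hr
  have hm : 0 < min (min r₁ r₂) 1 := lt_min (lt_min hr₁ hr₂) one_pos
  have hr0 : 0 < r := by positivity
  have hcr : c * r < min (min r₁ r₂) 1 := by
    rw [hr]; field_simp; linarith
  have hsmall : ∀ y ∈ closedBallInterp i ν x₀ r, interpNorm i μ (y - x₀) < min (min r₁ r₂) 1 := by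
    intro y hy
    refine lt_of_le_of_lt ?_ hcr
    exact (interpNorm_le_of_le hμ.le hμν (sub_mem_interpSpace hy.1 hxν)).trans
      (mul_le_mul_of_nonneg_left hy.2 hc0.le)
  have hmem : ∀ y ∈ closedBallInterp i ν x₀ r, y ∈ V := fun y hy =>
    H₁ y (interpSpace_anti hμν hy.1)
      ((hsmall y hy).trans_le ((min_le_left _ _).trans (min_le_left _ _)))
  -- Because ν ≥ β, the E_β-norms in the F₂-estimate are bounded by N and their powers become
  -- constants.
  set N := c * (interpNorm i ν x₀ + r) with hN
  have hN0 : 0 ≤ N := by have := interpNorm_nonneg i ν x₀; positivity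
  have hyN : ∀ y ∈ closedBallInterp i ν x₀ r, interpNorm i β y ≤ N := fun y hy => by
    refine (interpNorm_le_of_le (hμ.trans hμβ).le hβν hy.1).trans ?_
    have := interpNorm_add_le hν.le (sub_mem_interpSpace hy.1 hxν) hxν
    rw [sub_add_cancel] at this
    have := hy.2
    rw [hN]
    gcongr
    linarith
  set S := ∑ j, (1 + N ^ ρ j + N ^ ρ j) * c with hS
  have hS0 : 0 ≤ S := Finset.sum_nonneg fun j _ => by
    have := Real.rpow_nonneg hN0 (ρ j)
    positivity
  refine ⟨r, hr0, |L| * c + K * S, by positivity, hmem, fun y hy z hz => ?_⟩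
  have hD := sub_mem_interpSpace hy.1 hz.1
  have hD0 := interpNorm_nonneg i ν (y - z)
  obtain ⟨h1, h2⟩ := H₂ y (hmem y hy) z (hmem z hz)
    ((hsmall y hy).trans_le ((min_le_left _ _).trans (min_le_right _ _)))
    ((hsmall z hz).trans_le ((min_le_left _ _).trans (min_le_right _ _)))
  have hL : L * interpNorm i μ (y - z) ≤ |L| * c * interpNorm i ν (y - z) := by
    calc _ ≤ |L| * interpNorm i μ (y - z) :=
          mul_le_mul_of_nonneg_right (le_abs_self L) (interpNorm_nonneg _ _ _)
      _ ≤ |L| * (c * interpNorm i ν (y - z)) := by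
          gcongr; exact interpNorm_le_of_le hμ.le hμν hD
      _ = _ := by ring
  have h3 : ‖F₂ y - F₂ z‖ ≤ K * S * interpNorm i ν (y - z) := by
    refine (hF y ⟨⟨interpSpace_anti hμν hy.1, ((hsmall y hy).trans_le (min_le_right _ _)).le⟩,
      hmem y hy, interpSpace_anti hβν hy.1⟩ z ⟨⟨interpSpace_anti hμν hz.1,
      ((hsmall z hz).trans_le (min_le_right _ _)).le⟩, hmem z hz,
      interpSpace_anti hβν hz.1⟩).trans ?_
    rw [mul_assoc, hS, Finset.sum_mul]
    refine mul_le_mul_of_nonneg_left (Finset.sum_le_sum fun j _ => ?_) hK.le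
    obtain ⟨⟨hb1, hb2⟩, hρ, -⟩ := hbρ j
    have e1 := Real.rpow_le_rpow (interpNorm_nonneg i β y) (hyN y hy) hρ
    have e2 := Real.rpow_le_rpow (interpNorm_nonneg i β z) (hyN z hz) hρ
    have e3 := interpNorm_le_of_le (hμ.le.trans hb1) (hb2.trans hβν) hD
    have e4 := Real.rpow_nonneg hN0 (ρ j)
    rw [mul_assoc]
    gcongr
    · exact interpNorm_nonneg _ _ _
  have hKS : 0 ≤ K * S * interpNorm i ν (y - z) := by positivity
  have hLc : 0 ≤ |L| * c * interpNorm i ν (y - z) := by positivity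
  constructor
  · linarith
  · have : F₁ y + F₂ y - (F₁ z + F₂ z) = (F₁ y - F₁ z) + (F₂ y - F₂ z) := by abel
    rw [this]
    refine (norm_add_le _ _).trans ?_
    linarith

theorem continuousOn_comp_of_lipschitz {G : Type*} [NormedAddCommGroup G] {s : Set E₀}
    {Φ : E₀ → G} {L : ℝ} (hL : 0 ≤ L) (hν : 0 ≤ ν) (hν1 : ν ≤ 1)
    (hΦ : ∀ y ∈ s, ∀ z ∈ s, ‖Φ y - Φ z‖ ≤ L * interpNorm i ν (y - z)) {v : ℝ → E₁} {J : Set ℝ}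
    (hv : ContinuousOn v J) (hs : ∀ t ∈ J, i (v t) ∈ s) :
    ContinuousOn (fun t => Φ (i (v t))) J := by
  have h : LipschitzOnWith (Real.toNNReal (L * (1 + ‖i‖))) (fun a => Φ (i a)) (i ⁻¹' s) := by
    refine LipschitzOnWith.of_dist_le_mul fun a ha b hb => ?_
    rw [Real.coe_toNNReal _ (by positivity), dist_eq_norm, dist_eq_norm, mul_assoc]
    refine (hΦ _ ha _ hb).trans ?_
    rw [← map_sub]
    gcongr
    exact interpNorm_apply_le hν hν1 _
  exact h.continuousOn.comp hv hs

/-- The right hand side of the fixed point equation for the frozen coefficient `B`. -/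
def frozenRHS (i : E₁ →L[ℝ] E₀) (B : E₁ →L[ℝ] E₀) (A : E₀ → E₁ →L[ℝ] E₀) (F : E₀ → E₀)
    (v : ℝ → E₁) (t : ℝ) : E₀ :=
  (B - A (i (v t))) (v t) + F (i (v t))

variable {r L : ℝ}

/-- Each of three terms carries a factor η: A(x₀) − A(v₁) by closeness to x₀, (A(v₁) − A(v₂))v₂ by
the weighted norm of v₂, and the F-difference by t^(1−ν). -/
theorem weight_frozenRHS_sub_le (hμ1 : ν < 1)
    (hAF : ∀ y ∈ closedBallInterp i ν x₀ r, ∀ z ∈ closedBallInterp i ν x₀ r,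
      ‖A y - A z‖ ≤ L * interpNorm i ν (y - z) ∧ ‖F y - F z‖ ≤ L * interpNorm i ν (y - z))
    (hx₀ : x₀ ∈ interpSpace i ν) (hL : 0 ≤ L) (hr : 0 ≤ r) {v₁ v₂ : ℝ → E₁} {t η D : ℝ} (ht : 0 < t)
    (hηr : η ≤ r) (hη1 : interpNorm i ν (i (v₁ t) - x₀) ≤ η)
    (hη2 : interpNorm i ν (i (v₂ t) - x₀) ≤ η) (hη3 : t ^ (1 - ν) * ‖v₂ t‖ ≤ η)
    (hη4 : t ^ (1 - ν) ≤ η) (hD1 : t ^ (1 - ν) * ‖v₁ t - v₂ t‖ ≤ D)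
    (hD2 : interpNorm i ν (i (v₁ t) - i (v₂ t)) ≤ D) :
    t ^ (1 - ν) * ‖frozenRHS i (A x₀) A F v₁ t - frozenRHS i (A x₀) A F v₂ t‖ ≤
      3 * L * η * D := by
  have hp : 0 < t ^ (1 - ν) := Real.rpow_pos_of_pos ht _
  have hη0 : 0 ≤ η := hp.le.trans hη4
  have m1 : i (v₁ t) ∈ closedBallInterp i ν x₀ r := ⟨apply_mem_interpSpace hμ1 _, hη1.trans hηr⟩
  have m2 : i (v₂ t) ∈ closedBallInterp i ν x₀ r := ⟨apply_mem_interpSpace hμ1 _, hη2.trans hηr⟩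
  have m0 : x₀ ∈ closedBallInterp i ν x₀ r := ⟨hx₀, by rw [sub_self, interpNorm_zero]; exact hr⟩
  have a1 := (hAF _ m0 _ m1).1
  rw [interpNorm_sub_comm] at a1
  obtain ⟨a2, a3⟩ := hAF _ m1 _ m2
  have hdec : frozenRHS i (A x₀) A F v₁ t - frozenRHS i (A x₀) A F v₂ t =
      (A x₀ - A (i (v₁ t))) (v₁ t - v₂ t) - (A (i (v₁ t)) - A (i (v₂ t))) (v₂ t) +
        (F (i (v₁ t)) - F (i (v₂ t))) := by
    simp only [frozenRHS, _root_.sub_apply, map_sub]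
    abel
  have b1 : ‖(A x₀ - A (i (v₁ t))) (v₁ t - v₂ t)‖ ≤ L * η * ‖v₁ t - v₂ t‖ :=
    (ContinuousLinearMap.le_opNorm _ _).trans (by gcongr; exact a1.trans (by gcongr))
  have b2 : ‖(A (i (v₁ t)) - A (i (v₂ t))) (v₂ t)‖ ≤ L * D * ‖v₂ t‖ :=
    (ContinuousLinearMap.le_opNorm _ _).trans (by gcongr; exact a2.trans (by gcongr))
  have b3 : ‖F (i (v₁ t)) - F (i (v₂ t))‖ ≤ L * D := a3.trans (by gcongr)
  have hD0 : 0 ≤ D := (mul_nonneg hp.le (norm_nonneg _)).trans hD1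
  rw [hdec]
  calc _ ≤ t ^ (1 - ν) * (L * η * ‖v₁ t - v₂ t‖ + L * D * ‖v₂ t‖ + L * D) := by
        gcongr
        exact (norm_add_le _ _).trans (add_le_add ((norm_sub_le _ _).trans (add_le_add b1 b2)) b3)
    _ = L * η * (t ^ (1 - ν) * ‖v₁ t - v₂ t‖) + L * D * (t ^ (1 - ν) * ‖v₂ t‖) +
        L * D * t ^ (1 - ν) := by ring
    _ ≤ L * η * D + L * D * η + L * D * η := by gcongr
    _ = _ := by ring

/-- Comparison with the constant x₀ leaves a product of two small quantities and a term that is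
small for short times. -/
theorem weight_frozenRHS_le (hμ1 : ν < 1)
    (hAF : ∀ y ∈ closedBallInterp i ν x₀ r, ∀ z ∈ closedBallInterp i ν x₀ r,
      ‖A y - A z‖ ≤ L * interpNorm i ν (y - z) ∧ ‖F y - F z‖ ≤ L * interpNorm i ν (y - z))
    (hx₀ : x₀ ∈ interpSpace i ν) (hL : 0 ≤ L) (hr : 0 ≤ r) {v : ℝ → E₁} {t η : ℝ} (ht : 0 < t)
    (hηr : η ≤ r) (hη : interpNorm i ν (i (v t) - x₀) ≤ η) :
    t ^ (1 - ν) * ‖frozenRHS i (A x₀) A F v t‖ ≤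
      L * η * (t ^ (1 - ν) * ‖v t‖) + t ^ (1 - ν) * (‖F x₀‖ + L * η) := by
  have hp : 0 < t ^ (1 - ν) := Real.rpow_pos_of_pos ht _
  have m1 : i (v t) ∈ closedBallInterp i ν x₀ r := ⟨apply_mem_interpSpace hμ1 _, hη.trans hηr⟩
  have m0 : x₀ ∈ closedBallInterp i ν x₀ r := ⟨hx₀, by rw [sub_self, interpNorm_zero]; exact hr⟩
  have a1 := (hAF _ m0 _ m1).1
  rw [interpNorm_sub_comm] at a1
  have a2 := (hAF _ m1 _ m0).2
  have b1 : ‖(A x₀ - A (i (v t))) (v t)‖ ≤ L * η * ‖v t‖ :=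
    (ContinuousLinearMap.le_opNorm _ _).trans (by gcongr; exact a1.trans (by gcongr))
  have b2 : ‖F (i (v t))‖ ≤ ‖F x₀‖ + L * η := by
    have : ‖F (i (v t))‖ ≤ ‖F x₀‖ + ‖F (i (v t)) - F x₀‖ := by
      simpa using norm_add_le (F x₀) (F (i (v t)) - F x₀)
    refine this.trans ?_
    gcongr
    exact a2.trans (by gcongr)
  calc _ ≤ t ^ (1 - ν) * (L * η * ‖v t‖ + (‖F x₀‖ + L * η)) := by
        gcongr
        exact (norm_add_le _ _).trans (add_le_add b1 b2)
    _ = _ := by ring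

theorem memBC_frozenRHS (hν : 0 < ν) (hν1 : ν < 1)
    (hAF : ∀ y ∈ closedBallInterp i ν x₀ r, ∀ z ∈ closedBallInterp i ν x₀ r,
      ‖A y - A z‖ ≤ L * interpNorm i ν (y - z) ∧ ‖F y - F z‖ ≤ L * interpNorm i ν (y - z))
    (hx₀ : x₀ ∈ interpSpace i ν) (hL : 0 ≤ L) (hr : 0 ≤ r) (hT : 0 < T) {v : ℝ → E₁}
    (hv : MemBC ν T v) (hvr : ∀ t ∈ Ioc 0 T, interpNorm i ν (i (v t) - x₀) ≤ r) :
    MemBC ν T (frozenRHS i (A x₀) A F v) := by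
  have hm : ∀ t ∈ Ioc 0 T, i (v t) ∈ closedBallInterp i ν x₀ r := fun t ht =>
    ⟨apply_mem_interpSpace hν1 _, hvr t ht⟩
  refine memBC_of_tendsto ?_ ?_
  · exact ((continuousOn_const.sub (continuousOn_comp_of_lipschitz hL hν.le hν1.le
      (fun y hy z hz => (hAF y hy z hz).1) hv.1 hm)).clm_apply hv.1).add
      (continuousOn_comp_of_lipschitz hL hν.le hν1.le (fun y hy z hz => (hAF y hy z hz).2) hv.1 hm)
  · have h1 : Tendsto (fun t => L * r * (t ^ (1 - ν) * ‖v t‖) + t ^ (1 - ν) * (‖F x₀‖ + L * r))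
        (𝓝[>] 0) (𝓝 0) := by
      simpa using (hv.3.const_mul (L * r)).add
        ((tendsto_rpow_nhdsGT_zero (sub_pos.2 hν1)).mul_const (‖F x₀‖ + L * r))
    refine tendsto_of_tendsto_of_tendsto_of_le_of_le' tendsto_const_nhds h1 ?_ ?_
    · filter_upwards [self_mem_nhdsWithin] with t ht
      exact mul_nonneg (Real.rpow_nonneg (le_of_lt ht) _) (norm_nonneg _)
    · filter_upwards [Ioc_mem_nhdsGT hT] with t ht
      exact weight_frozenRHS_le hν1 hAF hx₀ hL hr ht.1 le_rfl (hvr t ht)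

variable [CompleteSpace E₀] [CompleteSpace E₁]

/-- Solvability of the quasilinear problem at level `ν`, with Lipschitz dependence on the initial
value. -/
theorem exists_isPrimitive_quasilinear (hi : Function.Injective i) (hμ : 0 < μ) (hμν : μ ≤ ν)
    (hν1 : ν < 1) (hB : A x₀ ∈ maxReg i μ) (hx₀ : x₀ ∈ interpSpace i ν) (hr : 0 < r) (hL : 0 ≤ L)
    (hAF : ∀ y ∈ closedBallInterp i ν x₀ r, ∀ z ∈ closedBallInterp i ν x₀ r,
      ‖A y - A z‖ ≤ L * interpNorm i ν (y - z) ∧ ‖F y - F z‖ ≤ L * interpNorm i ν (y - z)) :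
    ∃ τ > 0, ∃ ε > 0, ∃ σ > 0, ε ≤ r ∧ ∃ (u : E₀ → ℝ → E₁) (g : E₀ → ℝ → E₀),
      (∀ x ∈ closedBallInterp i ν x₀ ε, IsPrimitive i ν τ x (u x) (g x) ∧
        ∀ t ∈ Ioc 0 τ, i (u x t) ∈ closedBallInterp i ν x₀ r ∧
          g x t + A (i (u x t)) (u x t) = F (i (u x t))) ∧
      ∀ x₁ ∈ closedBallInterp i ν x₀ ε, ∀ x₂ ∈ closedBallInterp i ν x₀ ε, ∀ t ∈ Ioc 0 τ,
        t ^ (1 - ν) * (‖g x₁ t - g x₂ t‖ + ‖u x₁ t - u x₂ t‖) ≤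
          σ * interpNorm i ν (x₁ - x₂) := by
  have hν := hμ.trans_le hμν
  set B := A x₀ with hBdef
  obtain ⟨T, hT, C, hC, hlin⟩ := exists_linear_estimate hi hμ hμν hν1 hB
  obtain ⟨v₀, hv₀⟩ := (hlin T hT le_rfl).1 (fun _ => 0) memBC_zero x₀ hx₀
  -- With v₀ the reference solution for zero right-hand side and initial value x₀, candidates
  -- deviate from v₀ by 2(C + 1)ε at most, and v₀ costs a further (C + 1)ε for small τ; hence η = K
  -- ε. The choice of ε ensures η ≤ r and a contraction factor 3Lη(C + 1) = K²Lε ≤ 1/2.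
  set K := 3 * (C + 1) with hK
  have hK0 : 0 < K := by positivity
  set ε := min (r / K) (1 / (2 * K ^ 2 * (L + 1))) with hε
  have hε0 : 0 < ε := lt_min (by positivity) (by positivity)
  have hKr : K * ε ≤ r := by
    have := min_le_left (r / K) (1 / (2 * K ^ 2 * (L + 1)))
    rwa [le_div_iff₀' hK0] at this
  have hKL : K ^ 2 * L * ε ≤ 1 / 2 := by
    have h1 : ε ≤ 1 / (2 * K ^ 2 * (L + 1)) := min_le_right _ _
    rw [le_div_iff₀ (by positivity)] at h1
    have : 0 ≤ K ^ 2 * ε := by positivity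
    linarith
  set η := K * ε with hη
  obtain ⟨τ', hτ', hτ⟩ := mem_nhdsGT_iff_exists_Ioc_subset.1
    ((((hv₀.1.3.eventually (gt_mem_nhds (show 0 < (C + 1) * ε by positivity))).and
      ((hv₀.tendsto_interpNorm_sub hν hν1 hT).eventually
        (gt_mem_nhds (show 0 < (C + 1) * ε by positivity)))).and
      ((tendsto_rpow_nhdsGT_zero (sub_pos.2 hν1)).eventually (gt_mem_nhds
        (show 0 < η by positivity)))).and
      (((tendsto_rpow_nhdsGT_zero (sub_pos.2 hν1)).mul_const (‖F x₀‖ + L * η)).eventually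
        (gt_mem_nhds (show 0 * (‖F x₀‖ + L * η) < ε / 2 by rw [zero_mul]; positivity))))
  set τ := min τ' T with hτdef
  have hτ0 : 0 < τ := lt_min hτ' hT
  have hτT : τ ≤ T := min_le_right _ _
  have hsmall : ∀ t ∈ Ioc 0 τ, ((t ^ (1 - ν) * ‖v₀ t‖ < (C + 1) * ε ∧
      interpNorm i ν (i (v₀ t) - x₀) < (C + 1) * ε) ∧ t ^ (1 - ν) < η) ∧
      t ^ (1 - ν) * (‖F x₀‖ + L * η) < ε / 2 := fun t ht =>
    hτ ⟨ht.1, ht.2.trans (min_le_left _ _)⟩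
  obtain ⟨hex, hest⟩ := hlin τ hτ0 hτT
  -- The iteration runs over f, in a ball that does not depend on x, while the initial value is
  -- built into the linear solution. The value 0 outside E_ν is a mere default.
  have hsol : ∀ (x : E₀) (f : vanishingAtZero τ E₀), ∃ v : ℝ → E₁, x ∈ interpSpace i ν →
      IsPrimitive i ν τ x v (fun t => unweight ν f t - B (v t)) := by
    intro x f
    by_cases hx : x ∈ interpSpace i ν
    · obtain ⟨v, hv⟩ := hex _ (unweight_memBC f) x hx
      exact ⟨v, fun _ => hv⟩
    · exact ⟨0, fun h => absurd h hx⟩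
  choose sol hsol using hsol
  have hN0 : ∀ x, 0 ≤ interpNorm i ν x := interpNorm_nonneg i ν
  have hdiff : ∀ x₁ ∈ interpSpace i ν, ∀ x₂ ∈ interpSpace i ν, ∀ f₁ f₂ : vanishingAtZero τ E₀,
      ∀ t ∈ Ioc 0 τ,
      t ^ (1 - ν) * ‖sol x₁ f₁ t - sol x₂ f₂ t‖ ≤ C * (‖f₁ - f₂‖ + interpNorm i ν (x₁ - x₂)) ∧
      t ^ (1 - ν) * ‖(unweight ν f₁ t - B (sol x₁ f₁ t)) -
        (unweight ν f₂ t - B (sol x₂ f₂ t))‖ ≤ C * (‖f₁ - f₂‖ + interpNorm i ν (x₁ - x₂)) ∧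
      interpNorm i ν (i (sol x₁ f₁ t) - i (sol x₂ f₂ t)) ≤
        (C + 1) * (‖f₁ - f₂‖ + interpNorm i ν (x₁ - x₂)) := by
    intro x₁ hx₁ x₂ hx₂ f₁ f₂ t ht
    have h := (hsol x₁ f₁ hx₁).sub hν (hsol x₂ f₂ hx₂)
    have h' := h.congr (h := fun t => unweight ν (f₁ - f₂) t - B (sol x₁ f₁ t - sol x₂ f₂ t))
      hτ0 (fun _ _ => rfl) fun t _ => by
        beta_reduce; rw [unweight_sub, map_sub]; abel
    obtain ⟨a, b, c⟩ := hest _ _ _ (unweight_memBC _) h' ‖f₁ - f₂‖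
      (fun s hs => rpow_mul_norm_unweight_le _ hs) t ht
    refine ⟨a, ?_, ?_⟩
    · convert b using 3
      rw [unweight_sub, map_sub]; abel
    -- The linear estimate controls the distance to x₁ − x₂; adding that vector back turns C into C
    -- + 1.
    · have hd := sub_mem_interpSpace hx₁ hx₂
      have e := interpNorm_add_le hν.le (sub_mem_interpSpace
        (apply_mem_interpSpace hν1 (sol x₁ f₁ t - sol x₂ f₂ t)) hd) hd
      rw [sub_add_cancel, map_sub] at e
      rw [map_sub] at c
      have := norm_nonneg (f₁ - f₂)
      linarith
  have hsol0 : ∀ t ∈ Ioc 0 τ, sol x₀ 0 t = v₀ t := by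
    intro t ht
    have h := (hsol x₀ 0 hx₀).sub hν (hv₀.mono_right hτT)
    rw [sub_self] at h
    have h' := h.congr (h := fun t => (0 : E₀) - B (sol x₀ 0 t - v₀ t))
      hτ0 (fun _ _ => rfl) fun t _ => by
        have : unweight ν (0 : vanishingAtZero τ E₀) t = 0 := by
          simpa using unweight_smul (μ := ν) 0 (0 : vanishingAtZero τ E₀) t
        beta_reduce; rw [this, map_sub]; abel
    have a := (hest (fun _ => 0) _ _ memBC_zero h' 0 (fun s _ => by simp) t ht).1
    rw [interpNorm_zero, add_zero, mul_zero] at a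
    have := nonpos_of_mul_nonpos_right a (Real.rpow_pos_of_pos ht.1 _)
    exact sub_eq_zero.1 (norm_le_zero_iff.1 this)
  have hball : ∀ x ∈ closedBallInterp i ν x₀ ε, ∀ f : vanishingAtZero τ E₀, ‖f‖ ≤ ε →
      ∀ t ∈ Ioc 0 τ, t ^ (1 - ν) * ‖sol x f t‖ ≤ η ∧ interpNorm i ν (i (sol x f t) - x₀) ≤ η := by
    intro x hx f hf t ht
    obtain ⟨a, -, c⟩ := hdiff x hx.1 x₀ hx₀ f 0 t ht
    rw [hsol0 t ht, sub_zero] at a c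
    obtain ⟨⟨⟨s1, s2⟩, -⟩, -⟩ := hsmall t ht
    have hd : ‖f‖ + interpNorm i ν (x - x₀) ≤ 2 * ε := by linarith [hx.2]
    have hd1 := mul_le_mul_of_nonneg_left hd hC.le
    have hd2 := mul_le_mul_of_nonneg_left hd (show 0 ≤ C + 1 by positivity)
    have e : η = 3 * ((C + 1) * ε) := by rw [hη, hK]; ring
    constructor
    · have h1 : ‖sol x f t‖ ≤ ‖sol x f t - v₀ t‖ + ‖v₀ t‖ := by
        simpa using norm_add_le (sol x f t - v₀ t) (v₀ t)
      have h2 := mul_le_mul_of_nonneg_left h1 (Real.rpow_nonneg ht.1.le (1 - ν))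
      linarith
    · have h1 := interpNorm_sub_le_sub_add_sub (i := i) hν.le
        (apply_mem_interpSpace hν1 (sol x f t)) (apply_mem_interpSpace hν1 (v₀ t)) hx₀
      linarith
  have hG : ∀ (x : E₀) (f : vanishingAtZero τ E₀), ∃ g : vanishingAtZero τ E₀,
      x ∈ closedBallInterp i ν x₀ ε → ‖f‖ ≤ ε →
        EqOn (unweight ν g) (frozenRHS i B A F (sol x f)) (Ioc 0 τ) := by
    intro x f
    by_cases h : x ∈ closedBallInterp i ν x₀ ε ∧ ‖f‖ ≤ ε
    · obtain ⟨g, hg⟩ := (memBC_frozenRHS hν hν1 hAF hx₀ hL hr.le hτ0 (hsol x f h.1.1).1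
        fun t ht => (hball x h.1 f h.2 t ht).2.trans hKr).exists_unweight_eqOn hν1
      exact ⟨g, fun _ _ => hg⟩
    · exact ⟨0, fun h1 h2 => absurd ⟨h1, h2⟩ h⟩
  choose G hG using hG
  have hGlip : ∀ x₁ ∈ closedBallInterp i ν x₀ ε, ∀ x₂ ∈ closedBallInterp i ν x₀ ε,
      ∀ f₁ f₂ : vanishingAtZero τ E₀, ‖f₁‖ ≤ ε → ‖f₂‖ ≤ ε →
      ‖G x₁ f₁ - G x₂ f₂‖ ≤ 1 / 2 * (‖f₁ - f₂‖ + interpNorm i ν (x₁ - x₂)) := by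
    intro x₁ hx₁ x₂ hx₂ f₁ f₂ hf₁ hf₂
    have hs0 : 0 ≤ ‖f₁ - f₂‖ + interpNorm i ν (x₁ - x₂) := add_nonneg (norm_nonneg _) (hN0 _)
    refine norm_le_of_unweight (μ := ν) _ (by positivity) fun t ht => ?_
    rw [unweight_sub, hG x₁ f₁ hx₁ hf₁ ht, hG x₂ f₂ hx₂ hf₂ ht]
    obtain ⟨a, -, c⟩ := hdiff x₁ hx₁.1 x₂ hx₂.1 f₁ f₂ t ht
    obtain ⟨b1, b2⟩ := hball x₁ hx₁ f₁ hf₁ t ht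
    obtain ⟨c1, c2⟩ := hball x₂ hx₂ f₂ hf₂ t ht
    refine (weight_frozenRHS_sub_le hν1 hAF hx₀ hL hr.le ht.1 hKr b2 c2 c1
      (hsmall t ht).1.2.le (a.trans ?_) c).trans ?_
    · gcongr
      linarith
    · have e : 3 * L * η * ((C + 1) * (‖f₁ - f₂‖ + interpNorm i ν (x₁ - x₂))) =
          K ^ 2 * L * ε * (‖f₁ - f₂‖ + interpNorm i ν (x₁ - x₂)) := by rw [hη, hK]; ring
      rw [e]
      gcongr
  have hGmaps : ∀ x ∈ closedBallInterp i ν x₀ ε, ∀ f : vanishingAtZero τ E₀, ‖f‖ ≤ ε →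
      ‖G x f‖ ≤ ε := by
    intro x hx f hf
    refine norm_le_of_unweight (μ := ν) _ hε0.le fun t ht => ?_
    rw [hG x f hx hf ht]
    obtain ⟨b1, b2⟩ := hball x hx f hf t ht
    have h1 := weight_frozenRHS_le hν1 hAF hx₀ hL hr.le ht.1 hKr b2
    have h2 : L * η * (t ^ (1 - ν) * ‖sol x f t‖) ≤ L * η * η := by gcongr
    -- The quadratic term is at most ε/2 by the choice of ε, the remaining one by the choice of τ.
    have h3 : L * η * η = K ^ 2 * L * ε * ε := by rw [hη]; ring
    have h4 := mul_le_mul_of_nonneg_right hKL hε0.le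
    have h5 := (hsmall t ht).2
    linarith
  have hfix : ∀ x, ∃ f : vanishingAtZero τ E₀, x ∈ closedBallInterp i ν x₀ ε →
      ‖f‖ ≤ ε ∧ G x f = f := by
    intro x
    by_cases hx : x ∈ closedBallInterp i ν x₀ ε
    · obtain ⟨f, hf⟩ := exists_fixedPoint_closedBall (Z := vanishingAtZero τ E₀) (G := G x) hε0.le
        (hGmaps x hx) fun f g hf hg => by
          have := hGlip x hx x hx f g hf hg
          rwa [sub_self, interpNorm_zero, add_zero] at this
      exact ⟨f, fun _ => hf⟩
    · exact ⟨0, fun h => absurd h hx⟩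
  choose φ hφ using hfix
  -- At the fixed points the factor 1/2 is absorbed, giving ‖φ x₁ − φ x₂‖ ≤ |x₁ − x₂|. So u and g
  -- each differ by at most 2C|x₁ − x₂|, and σ = 4C.
  refine ⟨τ, hτ0, ε, hε0, 4 * C, by positivity, ?_, fun x => sol x (φ x),
    fun x t => unweight ν (φ x) t - B (sol x (φ x) t), fun x hx => ⟨hsol _ _ hx.1,
    fun t ht => ⟨⟨apply_mem_interpSpace hν1 _, ?_⟩, ?_⟩⟩, fun x₁ hx₁ x₂ hx₂ t ht => ?_⟩
  · have : 1 ≤ K := by rw [hK]; linarith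
    exact (le_mul_of_one_le_left hε0.le this).trans hKr
  · exact (hball x hx _ (hφ x hx).1 t ht).2.trans hKr
  · have h1 := hG x _ hx (hφ x hx).1 ht
    rw [(hφ x hx).2] at h1
    beta_reduce
    rw [h1, frozenRHS, _root_.sub_apply]
    abel
  · have h1 := hGlip x₁ hx₁ x₂ hx₂ _ _ (hφ x₁ hx₁).1 (hφ x₂ hx₂).1
    rw [(hφ x₁ hx₁).2, (hφ x₂ hx₂).2] at h1
    obtain ⟨a, b, -⟩ := hdiff x₁ hx₁.1 x₂ hx₂.1 (φ x₁) (φ x₂) t ht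
    have h2 : ‖φ x₁ - φ x₂‖ + interpNorm i ν (x₁ - x₂) ≤ 2 * interpNorm i ν (x₁ - x₂) := by
      linarith
    have h3 := mul_le_mul_of_nonneg_left h2 hC.le
    rw [mul_add]
    linarith

end Existence

end ContMaxReg

/-! ### The proposition -/

theorem proposition2p5 {E₀ E₁ : Type*} [NormedAddCommGroup E₀] [NormedSpace ℝ E₀]
    [CompleteSpace E₀] [NormedAddCommGroup E₁] [NormedSpace ℝ E₁] [CompleteSpace E₁]
    (i : E₁ →L[ℝ] E₀) (hi : Function.Injective i) (hd : DenseRange i)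
    (μ β μ' : ℝ) (hμ : 0 < μ) (hμβ : μ < β) (hβμ' : β ≤ μ') (hμ' : μ' < 1)
    (V : Set E₀) (hV : IsOpenInterp i μ V)
    (A : E₀ → E₁ →L[ℝ] E₀) (F₁ F₂ : E₀ → E₀)
    (hAF₁ : LocLipCoefficients i μ V A F₁) (hF₂ : SingularStructure i μ β V F₂)
    (x₀ : E₀) (hx₀ : x₀ ∈ V ∩ interpSpace i μ') :
    ∃ τ > 0, ∃ ε > 0, ∃ σ > 0, ∃ u : E₀ → ℝ → E₁,
      -- existence and uniqueness in the space with weight `μ'`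
      (∀ x ∈ closedBallInterp i μ' x₀ ε,
        IsSolution i μ' τ V A F₁ F₂ x (u x) ∧
        ∀ v, IsSolution i μ' τ V A F₁ F₂ x v → EqOn v (u x) (Ioc 0 τ)) ∧
      -- Lipschitz dependence on the initial value
      (∀ x₁ ∈ closedBallInterp i μ' x₀ ε, ∀ x₂ ∈ closedBallInterp i μ' x₀ ε,
        normE1 i μ' τ (u x₁ - u x₂) ≤ σ * interpNorm i μ' (x₁ - x₂)) ∧
      -- the solutions are the solutions in the space with weight `μ`: `u x` is one of them, and
      -- any other one agrees with `u x` on the common interval and has the weight `μ'` as well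
      (∀ x ∈ closedBallInterp i μ' x₀ ε,
        IsSolution i μ τ V A F₁ F₂ x (u x) ∧
        ∀ T > 0, ∀ v, IsSolution i μ T V A F₁ F₂ x v →
          EqOn v (u x) (Ioc 0 (min T τ)) ∧ IsSolution i μ' T V A F₁ F₂ x v) := by
  have hμμ' := hμβ.le.trans hβμ'
  have h0 := hμ.trans_le hμμ'
  have hβ1 := hβμ'.trans_lt hμ'
  obtain ⟨r, hr, L, hL, hrV, hAF⟩ := exists_lipschitz_coefficients hμ hμβ hβμ' hV hAF₁ hF₂ hx₀
  obtain ⟨τ, hτ, ε, hε, σ, hσ, hεr, u, g, hu, hLip⟩ :=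
    exists_isPrimitive_quasilinear (F := fun y => F₁ y + F₂ y) hi hμ hμμ' hμ' (hAF₁.1 x₀ hx₀.1)
      hx₀.2 hr hL hAF
  have hsol : ∀ x ∈ closedBallInterp i μ' x₀ ε, IsSolution i μ' τ V A F₁ F₂ x (u x) :=
    fun x hx => (isSolution_iff_exists h0 hτ).2 ⟨hrV x ⟨hx.1, hx.2.trans hεr⟩, g x, (hu x hx).1,
      fun t ht => ⟨hrV _ ((hu x hx).2 t ht).1, ((hu x hx).2 t ht).2⟩⟩
  -- Solutions of weight μ' are also of weight μ, so uniqueness in the larger class serves both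
  -- levels.
  have hunique : ∀ x ∈ closedBallInterp i μ' x₀ ε, ∀ T > 0, ∀ v,
      IsSolution i μ T V A F₁ F₂ x v → EqOn v (u x) (Ioc 0 (min T τ)) := fun x hx T hT v hv =>
    (hv.mono_right hμ (lt_min hT hτ) (min_le_left _ _)).eqOn hi hμ hμβ hβ1 hAF₁ hF₂ (lt_min hT hτ)
      (((hsol x hx).anti_weight hμ hμμ' hτ).mono_right hμ (lt_min hT hτ) (min_le_right _ _))
  refine ⟨τ, hτ, ε, hε, σ, hσ, u, fun x hx => ⟨hsol x hx, fun v hv => ?_⟩,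
    fun x₁ hx₁ x₂ hx₂ => ?_, fun x hx => ⟨(hsol x hx).anti_weight hμ hμμ' hτ,
    fun T hT v hv => ⟨hunique x hx T hT v hv,
      hv.of_eqOn hμ h0 hτ hT (hsol x hx) (hunique x hx T hT v hv)⟩⟩⟩
  · simpa using hunique x hx τ hτ v (hv.anti_weight hμ hμμ' hτ)
  · have : Nonempty (Ioc (0 : ℝ) τ) := ⟨⟨τ, hτ, le_rfl⟩⟩
    refine ciSup_le fun ⟨t, ht⟩ => ?_
    have h := ((hu x₁ hx₁).1.sub h0 (hu x₂ hx₂).1).timeDeriv_eq h0 ht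
    have h' : timeDeriv i τ (u x₁ - u x₂) t = g x₁ t - g x₂ t := h
    rw [h']
    exact hLip x₁ hx₁ x₂ hx₂ t ht
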